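/- **Setting.** Let $\mathcal X=\{1,\dots,N\}$ be the set of augmented samples and let $1\le k<N$. Let $\Omega$ be a measurable space of natural samples, $\mathcal P$ and $\mathcal P_{l}$ probability measures on $\Omega$ (all data, and labeled data of the single known class), and $\mathcal T(\cdot\mid\bar x)$ a Markov kernel from $\Omega$ to $\mathcal X$ (the augmentation distribution). Put $$A^{(u)}_{xx'}=\mathbb E_{\bar x\sim\mathcal P}\,\mathcal T(x\mid\bar x)\,\mathcal T(x'\mid\bar x),\qquad \mathfrak l_x=\mathbb E_{\bar x\sim\mathcal P_{l}}\,\mathcal T(x\mid\bar x),\qquad A(\delta)=\eta_uA^{(u)}+\delta\,\mathfrak l\mathfrak l^\top .$$ Assume that every row sum of $A(0)=\eta_uA^{(u)}$ equals $1$. Let $D(\delta)$ be the diagonal matrix of the row sums of $A(\delta)$ and $\tilde A(\delta)=D(\delta)^{-1/2}A(\delta)D(\delta)^{-1/2}$. A feature matrix $Z(\delta)\in\mathbb R^{N\times k}$, whose rows $z_1,\dots,z_N$ are the features, is any matrix with $$Z(\delta)Z(\delta)^\top=D(\delta)^{-1/2}\tilde A_k(\delta)D(\delta)^{-1/2},$$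 where $\tilde A_k(\delta)$ is the top-$k$ part of a singular value decomposition $\tilde A(\delta)=\sum_{j=1}^N\lambda_jv_jv_j^\top$, with $\lambda_1\ge\dots\ge\lambda_N\ge0$ and $(v_j)$ orthonormal. Let $Z=Z(0)$, $\tilde A^{(u)}=\tilde A(0)$, and let $\lambda_j,v_j$ be its singular values and vectors. Put $V_k=[v_1,\dots,v_k]$, $V_\varnothing=[v_{k+1},\dots,v_N]$, $\tilde A_k^{(u)}=\sum_{j\le k}\lambda_jv_jv_j^\top$ and $\mathcal G_k=\lambda_k/\lambda_{k+1}$ (with $\mathcal G_k=\infty$ and $1/\mathcal G_k=0$ if $\lambda_{k+1}=0<\lambda_k$). For a partition $\Pi$ of $\mathcal X$ into nonempty classes, let $\mu_\pi$ be the mean of the $z_i$ with $i\in\pi$, $\mu_\Pi$ the mean of all $z_i$, and $$\mathcal M_{intra}=\sum_{\pi\in\Pi}\sum_{i\in\pi}\|z_i-\mu_\pi\|^2,\qquad \mathcal M_{inter}=\sum_{\pi\in\Pi}|\pi|\,\|\mu_\pi-\mu_\Pi\|^2,\qquad \mathcal M_{kms}(\Pi,Z)=\mathcal M_{intra}/\mathcal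 M_{inter}.$$ Let $\eta_1=1/\mathcal M_{inter}(\Pi,Z)$, $\eta_2=\mathcal M_{intra}(\Pi,Z)/\mathcal M_{inter}(\Pi,Z)$ and $\Upsilon=(1+\eta_2)H_\Pi-I-\frac{\eta_2}{N}\mathbf 1\mathbf 1^\top$, where $(H_\Pi)_{xx'}=1/|\pi|$ if $x,x'$ lie in the same class $\pi$ and $(H_\Pi)_{xx'}=0$ otherwise. **Theorem.** For all $1\le k<N$ and all reals $c,m>0$, $g>1$ there are constants $C,\delta_0>0$, depending only on $N,k,c,m,g$, such that for all data as above with $\lambda_k\ge c$, $\mathcal G_k\ge g$ and $\mathcal M_{inter}(\Pi,Z)\ge m$, for every $0<\delta\le\delta_0$ and for every feature matrix $Z(\delta)$, the difference $\Delta_{kms}(\delta)=\mathcal M_{kms}(\Pi,Z)-\mathcal M_{kms}(\Pi,Z(\delta))$ satisfies $$\Bigl|\Delta_{kms}(\delta)-\delta\,\eta_1\operatorname{Tr}\Bigl(\Upsilon\bigl(V_kV_k^\top\mathfrak l\mathfrak l^\top(I+V_\varnothing V_\varnothing^\top)-2\tilde A_k^{(u)}\operatorname{diag}(\mathfrak l)\bigr)\Bigr)\Bigr|\le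 C\Bigl(\frac1{\mathcal G_k}+\delta^2\Bigr).$$ Moreover $\Upsilon$ encodes the clustering: $\Upsilon_{xx'}>0$ if $x\ne x'$ are in the same class, and $\Upsilon_{xx'}<0$ if $x,x'$ are in different classes and $\eta_2>0$. -/

import Mathlib

open MeasureTheory ProbabilityTheory Matrix
open scoped ENNReal

namespace OpenWorld

noncomputable section

/-! ### The augmentation graph on `N` augmented samples -/

/-- Self-supervised connectivity `A⁽ᵘ⁾`: the entry at `x, x'` is the expectation, for a natural
sample `w ∼ P`, of `T(x | w) * T(x' | w)`, where `T` is the augmentation kernel. -/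
def unlabeledAdj {Ω : Type*} [MeasurableSpace Ω] {N : ℕ} (P : Measure Ω)
    (T : Kernel Ω (Fin N)) : Matrix (Fin N) (Fin N) ℝ :=
  fun x x' => ∫ w, (T w).real {x} * (T w).real {x'} ∂P

/-- Semantic connection to the labeled data: `𝔩 x` is the expectation of `T(x | w)` for `w ∼ Pl`,
where `Pl` is the distribution of the labeled samples of the (single) known class. -/
def labelVec {Ω : Type*} [MeasurableSpace Ω] {N : ℕ} (Pl : Measure Ω)
    (T : Kernel Ω (Fin N)) : Fin N → ℝ :=
  fun x => ∫ w, (T w).real {x} ∂Pl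

/-- The perturbed adjacency matrix `A(δ) = ηu A⁽ᵘ⁾ + δ 𝔩 𝔩ᵀ`. -/
def adj {Ω : Type*} [MeasurableSpace Ω] {N : ℕ} (P Pl : Measure Ω) (T : Kernel Ω (Fin N))
    (ηu δ : ℝ) : Matrix (Fin N) (Fin N) ℝ :=
  ηu • unlabeledAdj P T + δ • vecMulVec (labelVec Pl T) (labelVec Pl T)

/-- The degree (row sum) of a vertex. -/
def degree {N : ℕ} (A : Matrix (Fin N) (Fin N) ℝ) (x : Fin N) : ℝ := ∑ x', A x x'

/-- `D^{-1/2}`, where `D` is the diagonal matrix of the degrees of `A`. -/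
def degInvSqrt {N : ℕ} (A : Matrix (Fin N) (Fin N) ℝ) : Matrix (Fin N) (Fin N) ℝ :=
  diagonal fun x => (Real.sqrt (degree A x))⁻¹

/-- The normalized adjacency matrix `D^{-1/2} A D^{-1/2}`. -/
def normAdj {N : ℕ} (A : Matrix (Fin N) (Fin N) ℝ) : Matrix (Fin N) (Fin N) ℝ :=
  degInvSqrt A * A * degInvSqrt A

/-! ### Singular values and top-`k` components -/

/-- `B = U diag(σ) Uᵀ` is a singular value decomposition of the symmetric positive semidefinite
matrix `B`: `U` is orthogonal, and the singular values `σ` are nonnegative and listed in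
nonincreasing order. The columns of `U` are the singular vectors. -/
structure IsSymmSVD {N : ℕ} (B U : Matrix (Fin N) (Fin N) ℝ) (σ : Fin N → ℝ) : Prop where
  orthogonal : Uᵀ * U = 1
  antitone : Antitone σ
  nonneg : ∀ j, 0 ≤ σ j
  eq : B = U * diagonal σ * Uᵀ

/-- `V_k`: the first `k` singular vectors, as columns. -/
def topVecs {N k : ℕ} (hk : k < N) (U : Matrix (Fin N) (Fin N) ℝ) : Matrix (Fin N) (Fin k) ℝ :=
  U.submatrix id (Fin.castLE hk.le)

/-- `V_∅`: the remaining `N - k` singular vectors, an orthonormal basis of the orthogonal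
complement of the column space of `V_k`. -/
def nullVecs {N k : ℕ} (hk : k < N) (U : Matrix (Fin N) (Fin N) ℝ) :
    Matrix (Fin N) (Fin (N - k)) ℝ :=
  U.submatrix id fun j => ⟨k + j.1, by have := j.2; omega⟩

/-- The rank-`k` truncation `V_k Σ_k V_kᵀ`. -/
def truncation {N k : ℕ} (hk : k < N) (U : Matrix (Fin N) (Fin N) ℝ) (σ : Fin N → ℝ) :
    Matrix (Fin N) (Fin N) ℝ :=
  topVecs hk U * diagonal (fun j : Fin k => σ (Fin.castLE hk.le j)) * (topVecs hk U)ᵀ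

/-- The `k`-th singular value (counted from `1`); it is only used for `0 < k`. -/
def kthValue {N k : ℕ} (hk : k < N) (σ : Fin N → ℝ) : ℝ := σ ⟨k - 1, by omega⟩

/-- The `(k+1)`-th singular value (counted from `1`). -/
def succValue {N k : ℕ} (hk : k < N) (σ : Fin N → ℝ) : ℝ := σ ⟨k, hk⟩

/-- The spectral gap `G_k = λ_k / λ_{k+1}`, which is `∞` if `λ_{k+1} = 0 < λ_k`. -/
def spectralGap {N k : ℕ} (hk : k < N) (σ : Fin N → ℝ) : ℝ≥0∞ :=
  ENNReal.ofReal (kthValue hk σ) / ENNReal.ofReal (succValue hk σ)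

/-- The rows of `Z` are `k`-dimensional features learned from the graph with adjacency matrix `A`:
`Z Zᵀ = D^{-1/2} Ã_k D^{-1/2}`, with `Ã_k` the top-`k` part of the singular value decomposition of
the normalized adjacency matrix `Ã`. -/
def IsFeature {N k : ℕ} (hk : k < N) (A : Matrix (Fin N) (Fin N) ℝ)
    (Z : Matrix (Fin N) (Fin k) ℝ) : Prop :=
  ∃ (U : Matrix (Fin N) (Fin N) ℝ) (σ : Fin N → ℝ), IsSymmSVD (normAdj A) U σ ∧
    Z * Zᵀ = degInvSqrt A * truncation hk U σ * degInvSqrt A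

/-! ### The K-means measure -/

/-- The mean of the feature vectors (rows of `Z`) with index in `s`. -/
def featureMean {N k : ℕ} (Z : Matrix (Fin N) (Fin k) ℝ) (s : Finset (Fin N)) :
    EuclideanSpace ℝ (Fin k) :=
  (s.card : ℝ)⁻¹ • ∑ i ∈ s, WithLp.toLp 2 (Z i)

/-- The intra-class measure. -/
def intraClass {N k : ℕ} (Q : Finpartition (Finset.univ : Finset (Fin N)))
    (Z : Matrix (Fin N) (Fin k) ℝ) : ℝ :=
  ∑ π ∈ Q.parts, ∑ i ∈ π, ‖WithLp.toLp 2 (Z i) - featureMean Z π‖ ^ 2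

/-- The inter-class measure. -/
def interClass {N k : ℕ} (Q : Finpartition (Finset.univ : Finset (Fin N)))
    (Z : Matrix (Fin N) (Fin k) ℝ) : ℝ :=
  ∑ π ∈ Q.parts, (π.card : ℝ) * ‖featureMean Z π - featureMean Z Finset.univ‖ ^ 2

/-- The K-means measure. -/
def kmeansMeasure {N k : ℕ} (Q : Finpartition (Finset.univ : Finset (Fin N)))
    (Z : Matrix (Fin N) (Fin k) ℝ) : ℝ :=
  intraClass Q Z / interClass Q Z

/-- `η₁ = 1 / M_inter(Π, Z)`. -/
def eta₁ {N k : ℕ} (Q : Finpartition (Finset.univ : Finset (Fin N)))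
    (Z : Matrix (Fin N) (Fin k) ℝ) : ℝ :=
  1 / interClass Q Z

/-- `η₂ = M_intra(Π, Z) / M_inter(Π, Z)`. -/
def eta₂ {N k : ℕ} (Q : Finpartition (Finset.univ : Finset (Fin N)))
    (Z : Matrix (Fin N) (Fin k) ℝ) : ℝ :=
  intraClass Q Z / interClass Q Z

/-- `H_Π`: the matrix that replaces each row by the mean of the rows in its class. -/
def classAverage {N : ℕ} (Q : Finpartition (Finset.univ : Finset (Fin N))) :
    Matrix (Fin N) (Fin N) ℝ :=
  fun x x' => if Q.part x = Q.part x' then ((Q.part x).card : ℝ)⁻¹ else 0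

/-- `Υ = (1 + η₂) H_Π - I - (η₂ / N) 𝟏 𝟏ᵀ`. -/
def upsilon {N : ℕ} (Q : Finpartition (Finset.univ : Finset (Fin N))) (η₂ : ℝ) :
    Matrix (Fin N) (Fin N) ℝ :=
  (1 + η₂) • classAverage Q - 1 - (η₂ / N) • vecMulVec 1 1

/-- `Tr (Υ (V_k V_kᵀ 𝔩 𝔩ᵀ (I + V_∅ V_∅ᵀ) - 2 Ã_k diag(𝔩)))`. -/
def leadingTrace {N k : ℕ} (hk : k < N) (Y : Matrix (Fin N) (Fin N) ℝ) (l : Fin N → ℝ)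
    (U : Matrix (Fin N) (Fin N) ℝ) (σ : Fin N → ℝ) : ℝ :=
  trace (Y * (topVecs hk U * (topVecs hk U)ᵀ * vecMulVec l l *
      (1 + nullVecs hk U * (nullVecs hk U)ᵀ)
    - (2 : ℝ) • (truncation hk U σ * diagonal l)))

end

end OpenWorld

/-! Both K-means terms are linear in the Gram matrix: `intraClass` is the trace of `Z * Zᵀ` against
`I - H`, and `interClass` the trace against `H - 11ᵀ/N`. So `kmeansMeasure` is a quotient of two
linear functionals of `Z * Zᵀ`, and `Υ` is the form that the quotient rule produces. What remains is
a first-order expansion of the Gram matrix with uniform constants.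

Write `B = A(0)`, which is already normalized, `M` for the normalized perturbed matrix, and `P`,
`P'` for their top-`k` spectral projections. A variational Davis–Kahan bound
(`gap_mul_frobenius_specProj_sub_le`) gives `P - P' = O(δ)`, using only the gap of `B`. The
truncation of `M` is exactly `P'M + MP' - P'MP' = M - (1-P')M(1-P')`. Replacing `P'` by `P` changes
this to first order only through `B(1-P)` and `(1-P)B`, both of size `λ_{k+1}`, so the cost is
`O(1/G_k + δ²)` (`isBigO_T'_sub_compress`). Then `M = B + δB' + O(δ²)` and `D^{-1/2} = 1 - (δ/2)
diag 𝔩 + O(δ²)` give the derivative `dS` of the Gram matrix (`isBigO_gram_sub`). Its trace against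
the symmetric `Υ` is the stated leading term (`leadingTrace_eq`), and `abs_div_sub_div_sub_le`
transfers the expansion to the quotient. -/

namespace OpenWorld

/-! ### Frobenius norm estimates. -/

section Frobenius

attribute [local instance] Matrix.frobeniusNormedAddCommGroup Matrix.frobeniusNormedSpace
  Matrix.frobeniusNormedRing Matrix.frobeniusNormedAlgebra

variable {N : ℕ}

theorem frobenius_sq (X : Matrix (Fin N) (Fin N) ℝ) : ‖X‖ ^ 2 = ∑ i, ∑ j, X i j ^ 2 := by
  have h : 0 ≤ ∑ i, ∑ j, X i j ^ 2 :=
    Finset.sum_nonneg fun i _ => Finset.sum_nonneg fun j _ => sq_nonneg _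
  rw [Matrix.frobenius_norm_def, ← Real.rpow_natCast, ← Real.rpow_mul]
  · simp
  · simpa using h

theorem frobenius_sq_eq_trace (X : Matrix (Fin N) (Fin N) ℝ) : ‖X‖ ^ 2 = trace (X * Xᵀ) := by
  rw [frobenius_sq]
  simp [trace, Matrix.mul_apply, sq]

theorem abs_apply_le_frobenius (X : Matrix (Fin N) (Fin N) ℝ) (i j : Fin N) :
    |X i j| ≤ ‖X‖ := by
  refine abs_le_of_sq_le_sq ?_ (norm_nonneg _)
  rw [frobenius_sq]
  calc X i j ^ 2 ≤ ∑ j, X i j ^ 2 :=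
        Finset.single_le_sum (f := fun j => X i j ^ 2) (fun _ _ => sq_nonneg _) (Finset.mem_univ j)
    _ ≤ _ := Finset.single_le_sum (f := fun i => ∑ j, X i j ^ 2)
        (fun _ _ => Finset.sum_nonneg fun _ _ => sq_nonneg _) (Finset.mem_univ i)

theorem abs_trace_le_frobenius (X : Matrix (Fin N) (Fin N) ℝ) : |trace X| ≤ N * ‖X‖ := by
  calc |trace X| ≤ ∑ i, |X i i| := Finset.abs_sum_le_sum_abs _ _
    _ ≤ ∑ _i : Fin N, ‖X‖ := Finset.sum_le_sum fun i _ => abs_apply_le_frobenius X i i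
    _ = N * ‖X‖ := by simp

theorem frobenius_le_of_abs_apply_le {X : Matrix (Fin N) (Fin N) ℝ} {K : ℝ} (hK : 0 ≤ K)
    (h : ∀ i j, |X i j| ≤ K) : ‖X‖ ≤ N * K := by
  refine le_of_sq_le_sq ?_ (by positivity)
  rw [frobenius_sq]
  calc ∑ i, ∑ j, X i j ^ 2 ≤ ∑ _i : Fin N, ∑ _j : Fin N, K ^ 2 :=
        Finset.sum_le_sum fun i _ => Finset.sum_le_sum fun j _ => sq_le_sq' (abs_le.1 (h i j)).1
          (abs_le.1 (h i j)).2
    _ = (N * K) ^ 2 := by simp; ring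

theorem frobenius_diagonal_le {d : Fin N → ℝ} {K : ℝ} (hK : 0 ≤ K) (h : ∀ i, |d i| ≤ K) :
    ‖diagonal d‖ ≤ N * K := by
  refine frobenius_le_of_abs_apply_le hK fun i j => ?_
  by_cases hij : i = j
  · subst hij; simpa using h i
  · simpa [hij] using hK

/-! ### Orthogonal diagonalizations and spectral projections -/

theorem mul_transpose_of_orthogonal {U : Matrix (Fin N) (Fin N) ℝ} (hU : Uᵀ * U = 1) :
    U * Uᵀ = 1 := mul_eq_one_comm.1 hU

theorem frobenius_orthogonal_le {U : Matrix (Fin N) (Fin N) ℝ} (hU : Uᵀ * U = 1) : ‖U‖ ≤ N := by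
  refine le_of_sq_le_sq ?_ (Nat.cast_nonneg N)
  rw [frobenius_sq_eq_trace, mul_transpose_of_orthogonal hU]
  rcases N with _ | n
  · simp
  · simp only [trace_one, Fintype.card_fin]
    push_cast
    nlinarith [(Nat.cast_nonneg n : (0 : ℝ) ≤ n)]

theorem conj_diagonal_mul {U : Matrix (Fin N) (Fin N) ℝ} (hU : Uᵀ * U = 1) (d e : Fin N → ℝ) :
    (U * diagonal d * Uᵀ) * (U * diagonal e * Uᵀ) = U * diagonal (fun j => d j * e j) * Uᵀ := by
  rw [← diagonal_mul_diagonal]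
  calc (U * diagonal d * Uᵀ) * (U * diagonal e * Uᵀ)
      = U * diagonal d * (Uᵀ * U) * diagonal e * Uᵀ := by simp only [Matrix.mul_assoc]
    _ = _ := by rw [hU]; simp only [Matrix.mul_assoc, Matrix.mul_one]

theorem conj_diagonal_transpose (U : Matrix (Fin N) (Fin N) ℝ) (d : Fin N → ℝ) :
    (U * diagonal d * Uᵀ)ᵀ = U * diagonal d * Uᵀ := by
  simp [Matrix.transpose_mul, Matrix.mul_assoc]

theorem frobenius_conj_diagonal_le {U : Matrix (Fin N) (Fin N) ℝ} (hU : Uᵀ * U = 1)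
    {d : Fin N → ℝ} {K : ℝ} (hK : 0 ≤ K) (h : ∀ i, |d i| ≤ K) :
    ‖U * diagonal d * Uᵀ‖ ≤ N * (N * K) * N := by
  have hUt : ‖Uᵀ‖ ≤ N := by
    apply frobenius_orthogonal_le
    rw [transpose_transpose]
    exact mul_transpose_of_orthogonal hU
  calc ‖U * diagonal d * Uᵀ‖ ≤ ‖U‖ * ‖diagonal d‖ * ‖Uᵀ‖ :=
        (norm_mul_le _ _).trans (mul_le_mul_of_nonneg_right (norm_mul_le _ _) (norm_nonneg _))
    _ ≤ N * (N * K) * N := by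
        gcongr
        · exact frobenius_orthogonal_le hU
        · exact frobenius_diagonal_le hK h

/-- The squared entries of the change of basis `Uᵀ * U'` form a doubly stochastic array when both
bases are orthonormal; this turns the variational principle for projections into scalar
inequalities. -/
theorem trace_conj_diagonal_mul (U U' : Matrix (Fin N) (Fin N) ℝ) (d e : Fin N → ℝ) :
    trace ((U * diagonal d * Uᵀ) * (U' * diagonal e * U'ᵀ)) =
      ∑ j, d j * ∑ i, e i * (Uᵀ * U') j i ^ 2 := by
  have h : trace ((U * diagonal d * Uᵀ) * (U' * diagonal e * U'ᵀ)) =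
      trace (diagonal d * ((Uᵀ * U') * diagonal e * (Uᵀ * U')ᵀ)) := by
    rw [Matrix.transpose_mul, transpose_transpose, trace_mul_comm, ← Matrix.mul_assoc,
      trace_mul_comm, ← Matrix.mul_assoc, trace_mul_comm, Matrix.mul_assoc]
    rw [← trace_mul_comm (diagonal d * _)]
    congr 1
    simp only [Matrix.mul_assoc]
  rw [h]
  simp only [trace, diag_apply, diagonal_mul]
  refine Finset.sum_congr rfl fun j _ => ?_
  rw [Matrix.mul_apply]
  congr 1
  refine Finset.sum_congr rfl fun i _ => ?_
  rw [mul_diagonal, transpose_apply]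
  ring

/-- The orthogonal projection onto the span of the first `k` columns of `U`. -/
noncomputable def specProj (k : ℕ) (U : Matrix (Fin N) (Fin N) ℝ) : Matrix (Fin N) (Fin N) ℝ :=
  U * diagonal (fun j => if j.1 < k then 1 else 0) * Uᵀ

theorem specProj_transpose (k : ℕ) (U : Matrix (Fin N) (Fin N) ℝ) :
    (specProj k U)ᵀ = specProj k U := conj_diagonal_transpose _ _

theorem specProj_sq {k : ℕ} {U : Matrix (Fin N) (Fin N) ℝ} (hU : Uᵀ * U = 1) :
    specProj k U * specProj k U = specProj k U := by
  rw [specProj, conj_diagonal_mul hU]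
  congr 3
  ext j
  split_ifs <;> simp

theorem frobenius_specProj_le (k : ℕ) {U : Matrix (Fin N) (Fin N) ℝ} (hU : Uᵀ * U = 1) :
    ‖specProj k U‖ ≤ N * (N * 1) * N :=
  frobenius_conj_diagonal_le hU zero_le_one fun i => by split_ifs <;> simp

theorem sum_lt_eq {k : ℕ} (hk : k < N) :
    ∑ j : Fin N, (if j.1 < k then (1 : ℝ) else 0) = k := by
  rw [Fin.sum_univ_eq_sum_range (fun j => if j < k then (1 : ℝ) else 0) N, Finset.sum_ite]
  have : (Finset.range N).filter (· < k) = Finset.range k := by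
    ext; simp; omega
  simp [this]

theorem trace_specProj {k : ℕ} (hk : k < N) {U : Matrix (Fin N) (Fin N) ℝ} (hU : Uᵀ * U = 1) :
    trace (specProj k U) = k := by
  rw [specProj, trace_mul_comm, ← Matrix.mul_assoc, hU, Matrix.one_mul, trace_diagonal,
    sum_lt_eq hk]

theorem sum_sq_row {O : Matrix (Fin N) (Fin N) ℝ} (hO : O * Oᵀ = 1) (j : Fin N) :
    ∑ i, O j i ^ 2 = 1 := by
  have := congrFun (congrFun hO j) j
  simpa [Matrix.mul_apply, sq] using this

theorem sum_sq_col {O : Matrix (Fin N) (Fin N) ℝ} (hO : Oᵀ * O = 1) (i : Fin N) :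
    ∑ j, O j i ^ 2 = 1 := by
  have := congrFun (congrFun hO i) i
  simpa [Matrix.mul_apply, sq] using this

/-- Trades rectangular blocks for a masked diagonal, so that all later algebra takes place in the
ring of square matrices. -/
theorem topVecs_mul {k : ℕ} (hk : k < N) (U : Matrix (Fin N) (Fin N) ℝ) (d : Fin N → ℝ) :
    topVecs hk U * diagonal (fun j : Fin k => d (Fin.castLE hk.le j)) * (topVecs hk U)ᵀ =
      U * diagonal (fun j => if j.1 < k then d j else 0) * Uᵀ := by
  ext x y
  rw [Matrix.mul_apply, Matrix.mul_apply]
  simp only [mul_diagonal, transpose_apply, topVecs, submatrix_apply, id]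
  obtain ⟨r, hr⟩ : ∃ r, N = k + r := ⟨N - k, by omega⟩
  subst hr
  rw [Fin.sum_univ_add]
  simp
  rfl

theorem topVecs_mul_transpose {k : ℕ} (hk : k < N) (U : Matrix (Fin N) (Fin N) ℝ) :
    topVecs hk U * (topVecs hk U)ᵀ = specProj k U := by
  have := topVecs_mul hk U fun _ => 1
  simpa [specProj] using this

theorem truncation_eq_conj {k : ℕ} (hk : k < N) (U : Matrix (Fin N) (Fin N) ℝ) (σ : Fin N → ℝ) :
    truncation hk U σ = U * diagonal (fun j => if j.1 < k then σ j else 0) * Uᵀ :=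
  topVecs_mul hk U σ

theorem nullVecs_mul_transpose {k : ℕ} (hk : k < N) {U : Matrix (Fin N) (Fin N) ℝ}
    (hU : Uᵀ * U = 1) : nullVecs hk U * (nullVecs hk U)ᵀ = 1 - specProj k U := by
  rw [eq_sub_iff_add_eq', ← topVecs_mul_transpose hk, ← mul_transpose_of_orthogonal hU]
  ext x y
  rw [Matrix.add_apply, Matrix.mul_apply, Matrix.mul_apply, Matrix.mul_apply]
  simp only [transpose_apply, topVecs, nullVecs, submatrix_apply, id]
  obtain ⟨r, hr⟩ : ∃ r, N = k + r := ⟨N - k, by omega⟩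
  subst hr
  rw [Fin.sum_univ_add]
  congr 1
  refine Fintype.sum_equiv (finCongr (by omega)) _ _ fun j => ?_
  rfl

/-! ### Perturbation theory of the top-`k` spectral projection. -/

namespace IsSymmSVD

variable {B U : Matrix (Fin N) (Fin N) ℝ} {σ : Fin N → ℝ} {k : ℕ}

theorem specProj_mul (h : IsSymmSVD B U σ) (hk : k < N) :
    specProj k U * B = truncation hk U σ := by
  rw [h.eq, specProj, conj_diagonal_mul h.orthogonal, truncation_eq_conj]
  simp

theorem mul_specProj (h : IsSymmSVD B U σ) (hk : k < N) :
    B * specProj k U = truncation hk U σ := by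
  rw [h.eq, specProj, conj_diagonal_mul h.orthogonal, truncation_eq_conj]
  simp

theorem le_frobenius (h : IsSymmSVD B U σ) (j : Fin N) : σ j ≤ N * ‖B‖ * N := by
  have h1 : diagonal σ = Uᵀ * B * U := by
    rw [h.eq]
    calc diagonal σ = (Uᵀ * U) * diagonal σ * (Uᵀ * U) := by rw [h.orthogonal]; simp
      _ = _ := by simp only [Matrix.mul_assoc]
  have hUt : ‖Uᵀ‖ ≤ N := by
    apply frobenius_orthogonal_le
    rw [transpose_transpose]
    exact mul_transpose_of_orthogonal h.orthogonal
  calc σ j = (diagonal σ) j j := by simp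
    _ ≤ |(diagonal σ) j j| := le_abs_self _
    _ ≤ ‖Uᵀ * B * U‖ := by rw [h1]; exact abs_apply_le_frobenius _ _ _
    _ ≤ ‖Uᵀ‖ * ‖B‖ * ‖U‖ :=
        (norm_mul_le _ _).trans (mul_le_mul_of_nonneg_right (norm_mul_le _ _) (norm_nonneg _))
    _ ≤ N * ‖B‖ * N := by
        gcongr
        exact frobenius_orthogonal_le h.orthogonal

theorem frobenius_sub_truncation_le (h : IsSymmSVD B U σ) (hk : k < N) :
    ‖B - truncation hk U σ‖ ≤ N * (N * succValue hk σ) * N := by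
  have h1 : B - truncation hk U σ =
      U * diagonal (fun j => if j.1 < k then 0 else σ j) * Uᵀ := by
    conv_lhs => rw [h.eq]
    rw [truncation_eq_conj, ← Matrix.sub_mul, ← Matrix.mul_sub, diagonal_sub]
    congr 3
    ext j
    split_ifs <;> simp
  rw [h1]
  refine frobenius_conj_diagonal_le h.orthogonal (h.nonneg _) fun j => ?_
  split_ifs with hj
  · rw [abs_zero]
    exact h.nonneg _
  · rw [abs_of_nonneg (h.nonneg _)]
    exact h.antitone (by rw [Fin.le_def]; simpa using hj)

/-- The top-`k` projection maximizes `trace (P * B)` among rank-`k` projections, with a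
quantitative defect controlled by the gap. -/
theorem gap_mul_le (h : IsSymmSVD B U σ) (hk0 : 0 < k) (hk : k < N)
    {U' : Matrix (Fin N) (Fin N) ℝ} (hU' : U'ᵀ * U' = 1) :
    (kthValue hk σ - succValue hk σ) * (k - trace (specProj k U * specProj k U')) ≤
      trace ((specProj k U - specProj k U') * B) := by
  set O := Uᵀ * U' with hO
  have hOO : O * Oᵀ = 1 := by
    rw [hO, Matrix.transpose_mul, transpose_transpose, Matrix.mul_assoc, ← Matrix.mul_assoc U',
      mul_transpose_of_orthogonal hU', Matrix.one_mul, h.orthogonal]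
  -- `w j` is the squared length of the projection of the `j`-th singular vector onto the competing
  -- `k`-dimensional space: weights in `[0, 1]` with total `k`.
  set w : Fin N → ℝ := fun j => ∑ i, (if i.1 < k then (1 : ℝ) else 0) * O j i ^ 2 with hw
  have hw0 : ∀ j, 0 ≤ w j := fun j => Finset.sum_nonneg fun i _ => by
    split_ifs <;> simp [sq_nonneg]
  have hw1 : ∀ j, w j ≤ 1 := fun j => by
    rw [← sum_sq_row hOO j]
    refine Finset.sum_le_sum fun i _ => ?_
    split_ifs <;> simp [sq_nonneg]
  have hws : ∑ j, w j = k := by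
    rw [hw, Finset.sum_comm]
    simp_rw [← Finset.mul_sum, sum_sq_col (mul_eq_one_comm.1 hOO), mul_one]
    exact sum_lt_eq hk
  have e1 : trace (specProj k U * specProj k U') =
      ∑ j : Fin N, (if j.1 < k then (1 : ℝ) else 0) * w j := trace_conj_diagonal_mul _ _ _ _
  have e2 : trace (specProj k U' * B) = ∑ j, σ j * w j := by
    rw [trace_mul_comm, h.eq]
    exact trace_conj_diagonal_mul _ _ _ _
  have e3 : trace (specProj k U * B) = ∑ j : Fin N, (if j.1 < k then (1 : ℝ) else 0) * σ j := by
    rw [h.eq, specProj, conj_diagonal_mul h.orthogonal, trace_mul_comm, ← Matrix.mul_assoc,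
      h.orthogonal, Matrix.one_mul, trace_diagonal]
  -- The `succValue` term sums to zero because the weights have total `k`; adding it makes the
  -- inequality true term by term. For `j < k` it reads `λ_k (1 - w j) ≤ σ j (1 - w j)`, otherwise
  -- `-λ_{k+1} w j ≤ -σ j w j`.
  have key : ∀ j : Fin N,
      (kthValue hk σ - succValue hk σ) *
          ((if j.1 < k then (1 : ℝ) else 0) - (if j.1 < k then (1 : ℝ) else 0) * w j) +
        succValue hk σ * ((if j.1 < k then (1 : ℝ) else 0) - w j) ≤
      (if j.1 < k then (1 : ℝ) else 0) * σ j - σ j * w j := by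
    intro j
    split_ifs with hj
    · have : kthValue hk σ ≤ σ j := h.antitone (by rw [Fin.le_def]; simp; omega)
      nlinarith [hw1 j]
    · have : σ j ≤ succValue hk σ := h.antitone (by rw [Fin.le_def]; simpa using hj)
      nlinarith [hw0 j]
  have := Finset.sum_le_sum fun j (_ : j ∈ Finset.univ) => key j
  rw [Finset.sum_add_distrib, ← Finset.mul_sum, ← Finset.mul_sum, Finset.sum_sub_distrib,
    Finset.sum_sub_distrib, Finset.sum_sub_distrib, sum_lt_eq hk, hws, sub_self, mul_zero,
    add_zero] at this
  rw [Matrix.sub_mul, trace_sub, e1, e2, e3]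
  exact this

theorem frobenius_specProj_sub_sq {U U' : Matrix (Fin N) (Fin N) ℝ} (hk : k < N)
    (hU : Uᵀ * U = 1) (hU' : U'ᵀ * U' = 1) :
    ‖specProj k U - specProj k U'‖ ^ 2 =
      2 * (k - trace (specProj k U * specProj k U')) := by
  rw [frobenius_sq_eq_trace, transpose_sub, specProj_transpose, specProj_transpose,
    Matrix.sub_mul, Matrix.mul_sub, Matrix.mul_sub, specProj_sq hU, specProj_sq hU', trace_sub,
    trace_sub, trace_sub, trace_specProj hk hU, trace_specProj hk hU',
    trace_mul_comm (specProj k U')]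
  ring

/-- A Davis–Kahan bound for the projections onto the top-`k` singular spaces. -/
theorem gap_mul_frobenius_specProj_sub_le (h : IsSymmSVD B U σ) (hk0 : 0 < k) (hk : k < N)
    {M U' : Matrix (Fin N) (Fin N) ℝ} {σ' : Fin N → ℝ} (h' : IsSymmSVD M U' σ') :
    (kthValue hk σ - succValue hk σ) * ‖specProj k U - specProj k U'‖ ≤ 2 * N * ‖M - B‖ := by
  have g1 := h.gap_mul_le hk0 hk h'.orthogonal
  have g2 := h'.gap_mul_le hk0 hk h.orthogonal
  have e := frobenius_specProj_sub_sq hk h.orthogonal h'.orthogonal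
  have e0 : 0 ≤ (k - trace (specProj k U * specProj k U') : ℝ) := by
    nlinarith [sq_nonneg ‖specProj k U - specProj k U'‖]
  have hs : succValue hk σ' ≤ kthValue hk σ' := h'.antitone (by rw [Fin.le_def]; simp)
  -- For `M` only the maximality of its own projection is used, so its gap may vanish. Adding the
  -- two variational inequalities leaves a trace against `M - B`, linear in `P - P'`, while the left
  -- side is quadratic.
  have g3 : 0 ≤ trace ((specProj k U' - specProj k U) * M) := by
    refine le_trans (mul_nonneg (sub_nonneg.2 hs) ?_) g2
    rwa [trace_mul_comm]
  have g4 : trace ((specProj k U - specProj k U') * B) +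
      trace ((specProj k U' - specProj k U) * M) =
      - trace ((specProj k U - specProj k U') * (M - B)) := by
    rw [← trace_add, ← trace_neg]
    congr 1
    noncomm_ring
  have g5 : |trace ((specProj k U - specProj k U') * (M - B))| ≤
      N * (‖specProj k U - specProj k U'‖ * ‖M - B‖) :=
    (abs_trace_le_frobenius _).trans (mul_le_mul_of_nonneg_left (norm_mul_le _ _)
      (Nat.cast_nonneg N))
  have g6 := neg_le_abs (trace ((specProj k U - specProj k U') * (M - B)))
  set r := ‖specProj k U - specProj k U'‖ with hr
  rcases (norm_nonneg _ : 0 ≤ r).eq_or_lt with h0 | h0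
  · rw [hr, ← h0, mul_zero]; positivity
  · have e' : trace (specProj k U * specProj k U') = k - r ^ 2 / 2 := by linarith
    rw [e'] at g1
    have : (kthValue hk σ - succValue hk σ) * r * r ≤ 2 * N * ‖M - B‖ * r := by
      linear_combination 2 * g1 + 2 * g3 + 2 * g4 + 2 * g5 + 2 * g6
    exact le_of_mul_le_mul_right this h0

/-- The Davis–Kahan bound with `M = B` forces the two projections to coincide. -/
theorem truncation_unique (h : IsSymmSVD B U σ) (hk0 : 0 < k) (hk : k < N)
    (hgap : succValue hk σ < kthValue hk σ) {U' : Matrix (Fin N) (Fin N) ℝ} {σ' : Fin N → ℝ}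
    (h' : IsSymmSVD B U' σ') : truncation hk U' σ' = truncation hk U σ := by
  have := h.gap_mul_frobenius_specProj_sub_le hk0 hk h'
  rw [sub_self, norm_zero, mul_zero] at this
  have h0 : ‖specProj k U - specProj k U'‖ = 0 :=
    le_antisymm (nonpos_of_mul_nonpos_right this (sub_pos.2 hgap)) (norm_nonneg _)
  rw [← h.specProj_mul, ← h'.specProj_mul, sub_eq_zero.1 (norm_eq_zero.1 h0)]

end IsSymmSVD

end Frobenius

end OpenWorld

namespace OpenWorld

/-! ### First-order expansion of the truncated normalized adjacency matrix -/

section Expansion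

attribute [local instance] Matrix.frobeniusNormedAddCommGroup Matrix.frobeniusNormedSpace
  Matrix.frobeniusNormedRing Matrix.frobeniusNormedAlgebra

open Asymptotics

variable {ι R : Type*} [NormedRing R]

/-- Along the filter `⊤`, `=O` means a bound with one constant on all of `ι`. With `ι` the type of
all `GraphPerturbation hk c g`, this is precisely uniformity in the data. -/
theorem isBigO_top_mul_bdd {f f' : ι → R} {h : ι → ℝ} (hf : f =O[⊤] h)
    (hf' : f' =O[⊤] fun _ => (1 : ℝ)) : (fun x => f x * f' x) =O[⊤] h := by
  simpa using hf.mul hf'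

theorem isBigO_top_bdd_mul {f f' : ι → R} {h : ι → ℝ} (hf : f =O[⊤] fun _ => (1 : ℝ))
    (hf' : f' =O[⊤] h) : (fun x => f x * f' x) =O[⊤] h := by
  simpa using hf.mul hf'

theorem isBigO_top_of_le {f : ι → R} {h : ι → ℝ} (C : ℝ) (hf : ∀ x, ‖f x‖ ≤ C * h x)
    (hh : ∀ x, 0 ≤ h x) : f =O[⊤] h :=
  isBigO_top.2 ⟨C, fun x => by rw [Real.norm_of_nonneg (hh x)]; exact hf x⟩

theorem isBigO_top_of_le_le {f g : ι → ℝ} (hf : ∀ x, 0 ≤ f x) (hg : ∀ x, f x ≤ g x) :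
    f =O[⊤] g :=
  isBigO_of_le _ fun x => by
    rw [Real.norm_of_nonneg (hf x), Real.norm_of_nonneg ((hf x).trans (hg x))]; exact hg x

/-- A stochastic symmetric matrix `B` with its singular value decomposition, together with a
rank-one perturbation `δ l lᵀ` and the decomposition of the normalized perturbed matrix. -/
structure GraphPerturbation {N k : ℕ} (hk : k < N) (c g : ℝ) where
  B : Matrix (Fin N) (Fin N) ℝ
  l : Fin N → ℝ
  δ : ℝ
  U : Matrix (Fin N) (Fin N) ℝ
  σ : Fin N → ℝ
  U' : Matrix (Fin N) (Fin N) ℝ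
  σ' : Fin N → ℝ
  B_nonneg : ∀ x y, 0 ≤ B x y
  B_sum : ∀ x, degree B x = 1
  l_nonneg : ∀ x, 0 ≤ l x
  l_sum : ∑ x, l x = 1
  δ_pos : 0 < δ
  δ_le : δ ≤ 1
  svd : IsSymmSVD B U σ
  svd' : IsSymmSVD (normAdj (B + δ • vecMulVec l l)) U' σ'
  le_kth : c ≤ kthValue hk σ
  gap : g * succValue hk σ ≤ kthValue hk σ

namespace GraphPerturbation

variable {N k : ℕ} {hk : k < N} {c g : ℝ} (D : GraphPerturbation hk c g)

noncomputable section

def A : Matrix (Fin N) (Fin N) ℝ := D.B + D.δ • vecMulVec D.l D.l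
def F : Matrix (Fin N) (Fin N) ℝ := degInvSqrt D.A
def M : Matrix (Fin N) (Fin N) ℝ := normAdj D.A
def L : Matrix (Fin N) (Fin N) ℝ := diagonal D.l
def W : Matrix (Fin N) (Fin N) ℝ := vecMulVec D.l D.l
def P : Matrix (Fin N) (Fin N) ℝ := specProj k D.U
def P' : Matrix (Fin N) (Fin N) ℝ := specProj k D.U'
def T : Matrix (Fin N) (Fin N) ℝ := truncation hk D.U D.σ
def T' : Matrix (Fin N) (Fin N) ℝ := truncation hk D.U' D.σ'
def F₁ : Matrix (Fin N) (Fin N) ℝ := 1 - (D.δ / 2) • D.L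
def ε : ℝ := succValue hk D.σ / kthValue hk D.σ
/-- The derivative of the normalized adjacency matrix at `δ = 0`. -/
def B' : Matrix (Fin N) (Fin N) ℝ := D.W - (2 : ℝ)⁻¹ • (D.L * D.B + D.B * D.L)
/-- The derivative of the truncation at `δ = 0`, up to a multiple of `λ_{k+1} / λ_k`. -/
def dT : Matrix (Fin N) (Fin N) ℝ :=
  D.P * D.W + D.W * D.P - D.P * D.W * D.P - (2 : ℝ)⁻¹ • (D.T * D.L + D.L * D.T)
/-- The derivative of the Gram matrix at `δ = 0`, up to a multiple of `λ_{k+1} / λ_k`. -/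
def dS : Matrix (Fin N) (Fin N) ℝ :=
  D.P * D.W + D.W * D.P - D.P * D.W * D.P - (D.T * D.L + D.L * D.T)
def gram : Matrix (Fin N) (Fin N) ℝ := D.F * D.T' * D.F

end

theorem l_le (x : Fin N) : D.l x ≤ 1 := by
  rw [← D.l_sum]
  exact Finset.single_le_sum (fun i _ => D.l_nonneg i) (Finset.mem_univ x)

theorem B_le (x y : Fin N) : D.B x y ≤ 1 := by
  rw [← D.B_sum x]
  exact Finset.single_le_sum (f := fun y => D.B x y) (fun i _ => D.B_nonneg x i)
    (Finset.mem_univ y)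

theorem degree_A (x : Fin N) : degree D.A x = 1 + D.δ * D.l x := by
  have h := D.B_sum x
  simp only [degree, A, Matrix.add_apply, Matrix.smul_apply, vecMulVec_apply, smul_eq_mul,
    Finset.sum_add_distrib] at h ⊢
  rw [h, ← Finset.mul_sum, ← Finset.mul_sum, D.l_sum, mul_one]

theorem F_eq : D.F = diagonal fun x => (Real.sqrt (1 + D.δ * D.l x))⁻¹ := by
  simp only [F, degInvSqrt, degree_A]

theorem ε_nonneg : 0 ≤ D.ε := div_nonneg (D.svd.nonneg _) (D.svd.nonneg _)

theorem isBigO_B : (B : GraphPerturbation hk c g → _) =O[⊤] fun _ => (1 : ℝ) :=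
  isBigO_top_of_le (N * 1) (fun D => by
    rw [mul_one]
    exact frobenius_le_of_abs_apply_le zero_le_one fun i j =>
      abs_le.2 ⟨by linarith [D.B_nonneg i j], D.B_le i j⟩) fun _ => zero_le_one

theorem isBigO_L : (L : GraphPerturbation hk c g → _) =O[⊤] fun _ => (1 : ℝ) :=
  isBigO_top_of_le (N * 1) (fun D => by
    rw [mul_one]
    exact frobenius_diagonal_le zero_le_one fun i =>
      abs_le.2 ⟨by linarith [D.l_nonneg i], D.l_le i⟩) fun _ => zero_le_one

theorem isBigO_W : (W : GraphPerturbation hk c g → _) =O[⊤] fun _ => (1 : ℝ) :=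
  isBigO_top_of_le (N * 1) (fun D => by
    rw [mul_one]
    refine frobenius_le_of_abs_apply_le zero_le_one fun i j => ?_
    rw [W, vecMulVec_apply, abs_of_nonneg (mul_nonneg (D.l_nonneg i) (D.l_nonneg j))]
    exact mul_le_one₀ (D.l_le i) (D.l_nonneg j) (D.l_le j)) fun _ => zero_le_one

theorem isBigO_P : (P : GraphPerturbation hk c g → _) =O[⊤] fun _ => (1 : ℝ) :=
  isBigO_top_of_le (N * (N * 1) * N) (fun D => by
    rw [mul_one]
    exact frobenius_specProj_le k D.svd.orthogonal) fun _ => zero_le_one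

theorem isBigO_P' : (P' : GraphPerturbation hk c g → _) =O[⊤] fun _ => (1 : ℝ) :=
  isBigO_top_of_le (N * (N * 1) * N) (fun D => by
    rw [mul_one]
    exact frobenius_specProj_le k D.svd'.orthogonal) fun _ => zero_le_one

theorem isBigO_one : (fun _ : GraphPerturbation hk c g => (1 : Matrix (Fin N) (Fin N) ℝ)) =O[⊤]
    fun _ => (1 : ℝ) :=
  isBigO_const_const _ one_ne_zero _

theorem isBigO_δ_one : (δ : GraphPerturbation hk c g → ℝ) =O[⊤] fun _ => (1 : ℝ) :=
  isBigO_top_of_le_le (fun D => D.δ_pos.le) fun D => D.δ_le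

theorem isBigO_δ_sq : (fun D : GraphPerturbation hk c g => D.δ ^ 2) =O[⊤] δ :=
  isBigO_top_of_le_le (fun D => sq_nonneg _) fun D => by nlinarith [D.δ_pos, D.δ_le]

theorem isBigO_δ_sq_error : (fun D : GraphPerturbation hk c g => D.δ ^ 2) =O[⊤]
    fun D => D.ε + D.δ ^ 2 :=
  isBigO_top_of_le_le (fun D => sq_nonneg _) fun D => by linarith [D.ε_nonneg]

theorem isBigO_ε_error : (ε : GraphPerturbation hk c g → ℝ) =O[⊤] fun D => D.ε + D.δ ^ 2 :=
  isBigO_top_of_le_le (fun D => D.ε_nonneg) fun D => by linarith [sq_nonneg D.δ]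

theorem isBigO_smul_δ {f : GraphPerturbation hk c g → Matrix (Fin N) (Fin N) ℝ}
    {h : GraphPerturbation hk c g → ℝ} (hf : f =O[⊤] h) :
    (fun D => D.δ • f D) =O[⊤] fun D => D.δ * h D :=
  (isBigO_refl δ _).smul hf

theorem T_eq : D.T = D.P * D.B := (D.svd.specProj_mul hk).symm
theorem T_eq' : D.T = D.B * D.P := (D.svd.mul_specProj hk).symm
theorem T'_eq : D.T' = D.P' * D.M := (D.svd'.specProj_mul hk).symm
theorem T'_eq' : D.T' = D.M * D.P' := (D.svd'.mul_specProj hk).symm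
theorem P_sq : D.P * D.P = D.P := specProj_sq D.svd.orthogonal
theorem P'_sq : D.P' * D.P' = D.P' := specProj_sq D.svd'.orthogonal

theorem abs_inv_sqrt_sub_le {t : ℝ} (ht : 0 ≤ t) :
    |(Real.sqrt (1 + t))⁻¹ - (1 - t / 2)| ≤ t ^ 2 := by
  set s := Real.sqrt (1 + t) with hs
  have hs2 : s ^ 2 = 1 + t := Real.sq_sqrt (by linarith)
  have hs1 : 1 ≤ s := Real.one_le_sqrt.2 (by linarith)
  have ht' : t = s ^ 2 - 1 := by linarith
  have h0 : 0 < s := by linarith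
  -- In terms of `s` the remainder and `t ^ 2` share the factor `(s - 1) ^ 2`; what is left is
  -- polynomial and holds for `s ≥ 1`.
  have e : s⁻¹ - (1 - t / 2) = (s - 1) ^ 2 * (s + 2) / (2 * s) := by
    rw [ht']; field_simp; ring
  rw [e, abs_of_nonneg (by positivity), div_le_iff₀ (by positivity), ht']
  have : (s ^ 2 - 1) ^ 2 * (2 * s) = (s - 1) ^ 2 * ((s + 1) ^ 2 * (2 * s)) := by ring
  rw [this]
  refine mul_le_mul_of_nonneg_left ?_ (sq_nonneg _)
  nlinarith

theorem isBigO_F_sub_F₁ : (fun D : GraphPerturbation hk c g => D.F - D.F₁) =O[⊤]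
    fun D => D.δ ^ 2 :=
  isBigO_top_of_le N (fun D => by
    have : D.F - D.F₁ =
        diagonal fun x => (Real.sqrt (1 + D.δ * D.l x))⁻¹ - (1 - D.δ * D.l x / 2) := by
      rw [F_eq, F₁, L, ← diagonal_one, ← diagonal_smul, diagonal_sub, diagonal_sub]
      congr 1
      ext x
      simp only [Pi.smul_apply, smul_eq_mul]
      ring
    rw [this]
    refine frobenius_diagonal_le (sq_nonneg _) fun x => ?_
    refine (abs_inv_sqrt_sub_le (mul_nonneg D.δ_pos.le (D.l_nonneg x))).trans ?_
    rw [mul_pow]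
    exact mul_le_of_le_one_right (sq_nonneg _) (pow_le_one₀ (D.l_nonneg x) (D.l_le x)))
    fun _ => sq_nonneg _

theorem isBigO_F₁ : (F₁ : GraphPerturbation hk c g → _) =O[⊤] fun _ => (1 : ℝ) := by
  refine isBigO_one.sub ?_
  have h := (isBigO_δ_one.const_mul_left (2⁻¹ : ℝ)).smul (isBigO_L (hk := hk) (c := c) (g := g))
  refine (h.congr (fun D => ?_) fun D => ?_)
  · rw [div_eq_inv_mul]
  · simp

theorem isBigO_F : (F : GraphPerturbation hk c g → _) =O[⊤] fun _ => (1 : ℝ) := by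
  refine ((isBigO_F_sub_F₁.trans (isBigO_δ_sq.trans isBigO_δ_one)).add isBigO_F₁).congr_left
    fun D => ?_
  simp

theorem isBigO_A : (A : GraphPerturbation hk c g → _) =O[⊤] fun _ => (1 : ℝ) := by
  refine isBigO_B.add ?_
  have h := (isBigO_smul_δ (isBigO_W (hk := hk) (c := c) (g := g)))
  exact (h.congr_right fun D => mul_one _).trans isBigO_δ_one

theorem isBigO_B' : (B' : GraphPerturbation hk c g → _) =O[⊤] fun _ => (1 : ℝ) :=
  isBigO_W.sub (((isBigO_top_mul_bdd isBigO_L isBigO_B).add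
    (isBigO_top_mul_bdd isBigO_B isBigO_L)).const_smul_left (2⁻¹ : ℝ) :
      (fun D : GraphPerturbation hk c g => (2 : ℝ)⁻¹ • (D.L * D.B + D.B * D.L)) =O[⊤]
        fun _ => (1 : ℝ))

/-- Sandwiching by `F = D^{-1/2}` agrees to second order with sandwiching by `1 - (δ/2) diag l`. -/
theorem isBigO_sandwich {X : GraphPerturbation hk c g → Matrix (Fin N) (Fin N) ℝ}
    (hX : X =O[⊤] fun _ => (1 : ℝ)) :
    (fun D => D.F * X D * D.F - (X D - (D.δ / 2) • (D.L * X D + X D * D.L))) =O[⊤]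
      fun D => D.δ ^ 2 := by
  have h1 := isBigO_top_mul_bdd (isBigO_top_mul_bdd isBigO_F_sub_F₁ hX) isBigO_F
  have h2 := isBigO_top_bdd_mul (isBigO_top_mul_bdd isBigO_F₁ hX) isBigO_F_sub_F₁
  have h3 := (isBigO_top_mul_bdd (isBigO_top_mul_bdd isBigO_L hX) isBigO_L).const_smul_left
    (4⁻¹ : ℝ)
  have h4 := (isBigO_refl (fun D : GraphPerturbation hk c g => D.δ ^ 2) ⊤).smul h3
  refine ((h1.add h2).add (h4.congr_right fun D => ?_)).congr_left fun D => ?_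
  · simp
  · have e : D.F₁ * X D * D.F₁ = X D - (D.δ / 2) • (D.L * X D + X D * D.L) +
        D.δ ^ 2 • (4⁻¹ : ℝ) • (D.L * X D * D.L) := by
      simp only [F₁, Matrix.sub_mul, Matrix.mul_sub, Matrix.one_mul, Matrix.mul_one,
        Matrix.smul_mul, Matrix.mul_smul]
      module
    have e2 : (D.F - D.F₁) * X D * D.F + D.F₁ * X D * (D.F - D.F₁) =
        D.F * X D * D.F - D.F₁ * X D * D.F₁ := by
      noncomm_ring
    simp only [Pi.smul_apply]
    rw [e2, e]
    abel

theorem isBigO_M_sub : (fun D : GraphPerturbation hk c g => D.M - D.B - D.δ • D.B') =O[⊤]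
    fun D => D.δ ^ 2 := by
  have h1 := isBigO_sandwich (isBigO_A (hk := hk) (c := c) (g := g))
  have h2 := ((isBigO_top_mul_bdd (isBigO_L (hk := hk) (c := c) (g := g)) isBigO_W).add
    (isBigO_top_mul_bdd isBigO_W isBigO_L)).const_smul_left (-2⁻¹ : ℝ)
  have h4 := (isBigO_refl (fun D : GraphPerturbation hk c g => D.δ ^ 2) ⊤).smul h2
  refine (h1.add (h4.congr_right fun D => ?_)).congr_left fun D => ?_
  · simp
  · have : D.M = D.F * D.A * D.F := rfl
    simp only [Pi.smul_apply]
    rw [this, B', show D.A = D.B + D.δ • D.W from rfl]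
    simp only [Matrix.add_mul, Matrix.mul_add, Matrix.smul_mul, Matrix.mul_smul]
    module

theorem isBigO_M_sub_B : (fun D : GraphPerturbation hk c g => D.M - D.B) =O[⊤] δ := by
  refine ((isBigO_M_sub.trans isBigO_δ_sq).add
    ((isBigO_smul_δ isBigO_B').congr_right fun D => mul_one _)).congr_left fun D => ?_
  simp

theorem isBigO_M : (M : GraphPerturbation hk c g → _) =O[⊤] fun _ => (1 : ℝ) := by
  refine ((isBigO_M_sub_B.trans isBigO_δ_one).add isBigO_B).congr_left fun D => ?_
  simp

theorem isBigO_T : (T : GraphPerturbation hk c g → _) =O[⊤] fun _ => (1 : ℝ) :=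
  (isBigO_top_mul_bdd isBigO_P isBigO_B).congr_left fun D => D.T_eq.symm

theorem isBigO_T' : (T' : GraphPerturbation hk c g → _) =O[⊤] fun _ => (1 : ℝ) :=
  (isBigO_top_mul_bdd isBigO_P' isBigO_M).congr_left fun D => D.T'_eq.symm

theorem kthValue_pos (hc : 0 < c) : 0 < kthValue hk D.σ := hc.trans_le D.le_kth

theorem isBigO_P_sub (hk0 : 0 < k) (hc : 0 < c) (hg : 1 < g) :
    (fun D : GraphPerturbation hk c g => D.P - D.P') =O[⊤] δ := by
  refine IsBigO.trans (isBigO_top.2 ⟨2 * N / (c * (1 - g⁻¹)), fun D => ?_⟩) isBigO_M_sub_B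
  have h := D.svd.gap_mul_frobenius_specProj_sub_le hk0 hk D.svd'
  have hg' : 0 < 1 - g⁻¹ := sub_pos.2 (inv_lt_one_of_one_lt₀ hg)
  -- The ratio bound `g` becomes an additive gap only thanks to the lower bound `c` on `λ_k`.
  have h1 : c * (1 - g⁻¹) ≤ kthValue hk D.σ - succValue hk D.σ := by
    have h2 : succValue hk D.σ ≤ g⁻¹ * kthValue hk D.σ := by
      rw [← div_eq_inv_mul, le_div_iff₀ (by linarith), mul_comm]
      exact D.gap
    nlinarith [D.le_kth]
  rw [div_mul_eq_mul_div, le_div_iff₀ (by positivity), mul_comm]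
  exact (mul_le_mul_of_nonneg_right h1 (norm_nonneg _)).trans h

/-- The discarded part has size `λ_{k+1} = ε λ_k`, and `λ_k` is bounded because `B` is. -/
theorem isBigO_B_sub_T (hc : 0 < c) :
    (fun D : GraphPerturbation hk c g => D.B - D.T) =O[⊤] ε := by
  obtain ⟨K, hK⟩ := isBigO_top.1 (isBigO_B (hk := hk) (c := c) (g := g))
  refine isBigO_top_of_le (N * N * N * (N * K * N)) (fun D => ?_) fun D => D.ε_nonneg
  have h1 := D.svd.frobenius_sub_truncation_le hk
  have h2 : kthValue hk D.σ ≤ N * K * N := by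
    refine (D.svd.le_frobenius _).trans ?_
    have := hK D
    simp only [norm_one, mul_one] at this
    gcongr
  have h3 : succValue hk D.σ = kthValue hk D.σ * D.ε := by
    rw [ε, mul_div_cancel₀ _ (D.kthValue_pos hc).ne']
  have h4 : succValue hk D.σ ≤ N * K * N * D.ε := by
    rw [h3]; exact mul_le_mul_of_nonneg_right h2 D.ε_nonneg
  calc ‖D.B - D.T‖ ≤ N * (N * succValue hk D.σ) * N := h1
    _ = N * N * N * succValue hk D.σ := by ring
    _ ≤ N * N * N * (N * K * N * D.ε) := by gcongr
    _ = _ := by ring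

theorem isBigO_T'_sub_T (hk0 : 0 < k) (hc : 0 < c) (hg : 1 < g) :
    (fun D : GraphPerturbation hk c g => D.T' - D.T) =O[⊤] δ := by
  have h1 := isBigO_top_mul_bdd (isBigO_P_sub (hk := hk) hk0 hc hg) isBigO_M
  have h2 := isBigO_top_bdd_mul isBigO_P (isBigO_M_sub_B (hk := hk) (c := c) (g := g))
  refine (h2.sub h1).congr_left fun D => ?_
  rw [T_eq, T'_eq]
  noncomm_ring

/-- With `R = P - P'` and `Q = 1 - P`, the difference is exactly `-(RMQ + QMR + RMR)`. Replacing `M`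
by `B` in the first two terms costs `O(δ²)`, and `BQ = QB = B - T` is `O(ε)`. -/
theorem isBigO_T'_sub_compress (hk0 : 0 < k) (hc : 0 < c) (hg : 1 < g) :
    (fun D : GraphPerturbation hk c g =>
      D.T' - (D.P * D.M + D.M * D.P - D.P * D.M * D.P)) =O[⊤] fun D => D.ε + D.δ ^ 2 := by
  have hR := isBigO_P_sub (hk := hk) hk0 hc hg
  have hR1 := hR.trans isBigO_δ_one
  have hQ := isBigO_one.sub (isBigO_P (hk := hk) (c := c) (g := g))
  have hBT := (isBigO_B_sub_T (hk := hk) (g := g) hc).trans isBigO_ε_error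
  have a1 := isBigO_top_bdd_mul hR1 hBT
  have a2 := isBigO_top_mul_bdd hBT hR1
  have a3 := (((isBigO_top_mul_bdd (hR.mul isBigO_M_sub_B) hQ).add
    ((isBigO_top_bdd_mul hQ isBigO_M_sub_B).mul hR)).add
    ((isBigO_top_mul_bdd hR isBigO_M).mul hR)).congr_right fun D => (sq D.δ).symm
  refine ((a1.add a2).add (a3.trans isBigO_δ_sq_error)).neg_left.congr_left fun D => ?_
  have e1 : D.T' = D.P' * D.M + D.M * D.P' - D.P' * D.M * D.P' := by
    rw [Matrix.mul_assoc, ← T'_eq', ← T'_eq]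
    nth_rewrite 4 [T'_eq]
    rw [← Matrix.mul_assoc, P'_sq, ← T'_eq]
    abel
  have e2 : D.B * D.P = D.T := D.T_eq'.symm
  have e3 : D.P * D.B = D.T := D.T_eq.symm
  have e4 : (D.P - D.P') * (D.B - D.T) = (D.P - D.P') * D.B * (1 - D.P) := by
    rw [← e2]; noncomm_ring
  have e5 : (D.B - D.T) * (D.P - D.P') = (1 - D.P) * D.B * (D.P - D.P') := by
    rw [← e3]; noncomm_ring
  rw [e1, e4, e5]
  noncomm_ring

/-- Inserting `M ≈ B + δB'` into the compression, the terms absent from `dT` are multiples of `PL(B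
- T)` and `(B - T)LP`, hence `O(ε)`. -/
theorem isBigO_T'_sub (hk0 : 0 < k) (hc : 0 < c) (hg : 1 < g) :
    (fun D : GraphPerturbation hk c g => D.T' - D.T - D.δ • D.dT) =O[⊤]
      fun D => D.ε + D.δ ^ 2 := by
  have h1 := isBigO_T'_sub_compress (hk := hk) hk0 hc hg
  have hM := (isBigO_M_sub (hk := hk) (c := c) (g := g)).trans isBigO_δ_sq_error
  have hBT := (isBigO_B_sub_T (hk := hk) (g := g) hc).trans isBigO_ε_error
  have h2 := ((isBigO_top_bdd_mul isBigO_P hM).add (isBigO_top_mul_bdd hM isBigO_P)).sub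
    (isBigO_top_mul_bdd (isBigO_top_bdd_mul isBigO_P hM) isBigO_P)
  have h3 := ((isBigO_top_bdd_mul (isBigO_top_bdd_mul isBigO_P isBigO_L) hBT).add
    (isBigO_top_mul_bdd hBT (isBigO_top_bdd_mul isBigO_L isBigO_P))).const_smul_left (-2⁻¹ : ℝ)
  have h4 := (isBigO_δ_one (hk := hk) (c := c) (g := g)).smul h3
  refine ((h1.add h2).add (h4.congr_right fun D => ?_)).congr_left fun D => ?_
  · simp
  · have e2 : D.B * D.P = D.T := D.T_eq'.symm
    have e3 : D.P * D.B = D.T := D.T_eq.symm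
    have e5 : D.T * D.P = D.T := by rw [T_eq', Matrix.mul_assoc, P_sq]
    have e6 (X) : D.P * (D.B * X) = D.T * X := by rw [← Matrix.mul_assoc, e3]
    simp only [Pi.smul_apply, B', dT, Matrix.mul_sub, Matrix.sub_mul, Matrix.mul_smul,
      Matrix.smul_mul, Matrix.mul_add, Matrix.add_mul, Matrix.mul_assoc, e2, e3, e5, e6]
    module

/-- The outer factors `D^{-1/2}` contribute a second `-(1/2)(TL + LT)`, which is why this term has
coefficient `1/2` in `dT` and `1` in `dS`. -/
theorem isBigO_gram_sub (hk0 : 0 < k) (hc : 0 < c) (hg : 1 < g) :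
    (fun D : GraphPerturbation hk c g => D.gram - D.T - D.δ • D.dS) =O[⊤]
      fun D => D.ε + D.δ ^ 2 := by
  have h1 := isBigO_T'_sub (hk := hk) hk0 hc hg
  have h2 := isBigO_T'_sub_T (hk := hk) hk0 hc hg
  have h3 := (isBigO_sandwich (isBigO_T' (hk := hk) (c := c) (g := g))).trans isBigO_δ_sq_error
  have h4 := isBigO_smul_δ (((isBigO_top_bdd_mul isBigO_L h2).add
    (isBigO_top_mul_bdd h2 isBigO_L)).const_smul_left (-2⁻¹ : ℝ))
  have h5 := (h4.congr_right fun D => (sq D.δ).symm).trans isBigO_δ_sq_error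
  refine ((h1.add h3).add h5).congr_left fun D => ?_
  simp only [Pi.smul_apply, gram, dT, dS, Matrix.mul_sub, Matrix.sub_mul]
  module

theorem isBigO_dS : (dS : GraphPerturbation hk c g → _) =O[⊤] fun _ => (1 : ℝ) :=
  (((isBigO_top_mul_bdd isBigO_P isBigO_W).add (isBigO_top_mul_bdd isBigO_W isBigO_P)).sub
    (isBigO_top_mul_bdd (isBigO_top_mul_bdd isBigO_P isBigO_W) isBigO_P)).sub
    ((isBigO_top_mul_bdd isBigO_T isBigO_L).add (isBigO_top_mul_bdd isBigO_L isBigO_T))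

theorem isBigO_gram_sub_T (hk0 : 0 < k) (hc : 0 < c) (hg : 1 < g) :
    (fun D : GraphPerturbation hk c g => D.gram - D.T) =O[⊤] δ := by
  have h2 := isBigO_T'_sub_T (hk := hk) hk0 hc hg
  have h3 := (isBigO_sandwich (isBigO_T' (hk := hk) (c := c) (g := g))).trans isBigO_δ_sq
  have h4 := isBigO_smul_δ (hk := hk) (c := c) (g := g) (((isBigO_top_bdd_mul isBigO_L
    isBigO_T').add
    (isBigO_top_mul_bdd isBigO_T' isBigO_L)).const_smul_left (-2⁻¹ : ℝ))
  refine ((h2.add h3).add (h4.congr_right fun D => mul_one _)).congr_left fun D => ?_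
  simp only [Pi.smul_apply, gram]
  module

end GraphPerturbation

end Expansion

end OpenWorld

namespace OpenWorld

/-! ### The K-means measure as a function of the Gram matrix -/

section KMeans

variable {N k : ℕ}

theorem sum_parts_sum (Q : Finpartition (Finset.univ : Finset (Fin N))) (f : Fin N → ℝ) :
    ∑ π ∈ Q.parts, ∑ i ∈ π, f i = ∑ i, f i := by
  rw [← Finset.sum_congr Q.biUnion_parts fun _ _ => rfl, Finset.sum_biUnion Q.disjoint]
  rfl

theorem inner_row (Z : Matrix (Fin N) (Fin k) ℝ) (i j : Fin N) :
    inner ℝ (WithLp.toLp 2 (Z i)) (WithLp.toLp 2 (Z j)) = (Z * Zᵀ) i j := by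
  simp [PiLp.inner_apply, Matrix.mul_apply, mul_comm]

theorem card_mul_norm_featureMean_sq (Z : Matrix (Fin N) (Fin k) ℝ) (s : Finset (Fin N)) :
    (s.card : ℝ) * ‖featureMean Z s‖ ^ 2 =
      (s.card : ℝ)⁻¹ * ∑ i ∈ s, ∑ j ∈ s, (Z * Zᵀ) i j := by
  rw [← real_inner_self_eq_norm_sq, featureMean, real_inner_smul_left, real_inner_smul_right,
    sum_inner]
  simp_rw [inner_sum, inner_row]
  rcases s.eq_empty_or_nonempty with rfl | hs
  · simp
  · have : (s.card : ℝ) ≠ 0 := by exact_mod_cast hs.card_ne_zero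
    field_simp

theorem card_smul_featureMean (Z : Matrix (Fin N) (Fin k) ℝ) (s : Finset (Fin N)) :
    (s.card : ℝ) • featureMean Z s = ∑ i ∈ s, WithLp.toLp 2 (Z i) := by
  rcases s.eq_empty_or_nonempty with rfl | hs
  · simp
  · have : (s.card : ℝ) ≠ 0 := by exact_mod_cast hs.card_ne_zero
    rw [featureMean, smul_smul, mul_inv_cancel₀ this, one_smul]

theorem sum_norm_sub_featureMean_sq (Z : Matrix (Fin N) (Fin k) ℝ) (s : Finset (Fin N)) :
    ∑ i ∈ s, ‖WithLp.toLp 2 (Z i) - featureMean Z s‖ ^ 2 =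
      ∑ i ∈ s, (Z * Zᵀ) i i - (s.card : ℝ) * ‖featureMean Z s‖ ^ 2 := by
  simp_rw [norm_sub_sq_real, ← real_inner_self_eq_norm_sq (WithLp.toLp 2 (Z _)), inner_row]
  rw [Finset.sum_add_distrib, Finset.sum_sub_distrib, ← Finset.mul_sum, ← sum_inner,
    ← card_smul_featureMean, real_inner_smul_left, real_inner_self_eq_norm_sq, Finset.sum_const,
    nsmul_eq_mul]
  ring

theorem trace_classAverage_mul (Q : Finpartition (Finset.univ : Finset (Fin N)))
    (S : Matrix (Fin N) (Fin N) ℝ) :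
    trace (classAverage Q * S) =
      ∑ π ∈ Q.parts, (π.card : ℝ)⁻¹ * ∑ i ∈ π, ∑ j ∈ π, S j i := by
  have h : ∀ π ∈ Q.parts, (π.card : ℝ)⁻¹ * ∑ i ∈ π, ∑ j ∈ π, S j i =
      ∑ i ∈ π, ((Q.part i).card : ℝ)⁻¹ * ∑ j ∈ Q.part i, S j i := fun π hπ => by
    rw [Finset.mul_sum]
    exact Finset.sum_congr rfl fun i hi => by rw [Q.part_eq_of_mem hπ hi]
  rw [Finset.sum_congr rfl h, sum_parts_sum]
  simp only [trace, diag_apply, Matrix.mul_apply, classAverage]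
  refine Finset.sum_congr rfl fun i _ => ?_
  rw [Finset.mul_sum]
  simp only [ite_mul, zero_mul]
  rw [← Finset.sum_filter]
  refine Finset.sum_congr ?_ fun _ _ => rfl
  ext j
  rw [Finset.mem_filter, Q.mem_part_iff_part_eq_part (Finset.mem_univ _) (Finset.mem_univ _)]
  simp [eq_comm]

/-- The quadratic form of the intra-class measure. -/
noncomputable def intraForm (Q : Finpartition (Finset.univ : Finset (Fin N))) :
    Matrix (Fin N) (Fin N) ℝ := 1 - classAverage Q

/-- The quadratic form of the inter-class measure. -/
noncomputable def interForm (Q : Finpartition (Finset.univ : Finset (Fin N))) :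
    Matrix (Fin N) (Fin N) ℝ := classAverage Q - (N : ℝ)⁻¹ • vecMulVec 1 1

theorem sum_parts_card_mul (Q : Finpartition (Finset.univ : Finset (Fin N)))
    (Z : Matrix (Fin N) (Fin k) ℝ) :
    ∑ π ∈ Q.parts, (π.card : ℝ) * ‖featureMean Z π‖ ^ 2 =
      trace (classAverage Q * (Z * Zᵀ)) := by
  rw [trace_classAverage_mul]
  refine Finset.sum_congr rfl fun π _ => ?_
  rw [card_mul_norm_featureMean_sq, Finset.sum_comm]

theorem intraClass_eq (Q : Finpartition (Finset.univ : Finset (Fin N)))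
    (Z : Matrix (Fin N) (Fin k) ℝ) : intraClass Q Z = trace (intraForm Q * (Z * Zᵀ)) := by
  simp only [intraClass, sum_norm_sub_featureMean_sq]
  rw [Finset.sum_sub_distrib, sum_parts_sum, sum_parts_card_mul, intraForm, Matrix.sub_mul,
    trace_sub, Matrix.one_mul]
  rfl

theorem interClass_eq (Q : Finpartition (Finset.univ : Finset (Fin N)))
    (Z : Matrix (Fin N) (Fin k) ℝ) : interClass Q Z = trace (interForm Q * (Z * Zᵀ)) := by
  have h1 : trace (((N : ℝ)⁻¹ • vecMulVec 1 1 : Matrix (Fin N) (Fin N) ℝ) * (Z * Zᵀ)) =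
      (N : ℝ) * ‖featureMean Z Finset.univ‖ ^ 2 := by
    have := card_mul_norm_featureMean_sq Z Finset.univ
    rw [Finset.card_univ, Fintype.card_fin] at this
    rw [this, Matrix.smul_mul, trace_smul, smul_eq_mul]
    congr 1
    refine Eq.trans ?_ Finset.sum_comm
    simp only [trace, diag_apply, Matrix.mul_apply (M := vecMulVec 1 1), vecMulVec_apply,
      Pi.one_apply, mul_one, one_mul]
  rw [interForm, Matrix.sub_mul, trace_sub, h1, ← sum_parts_card_mul]
  simp only [interClass, norm_sub_sq_real, mul_add, mul_sub]
  rw [Finset.sum_add_distrib, Finset.sum_sub_distrib]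
  -- The class means weighted by class size add up to `N` times the global mean.
  have h2 : ∑ π ∈ Q.parts, (π.card : ℝ) * (2 * inner ℝ (featureMean Z π)
      (featureMean Z Finset.univ)) = 2 * (N * ‖featureMean Z Finset.univ‖ ^ 2) := by
    have : ∀ π ∈ Q.parts, (π.card : ℝ) * (2 * inner ℝ (featureMean Z π)
        (featureMean Z Finset.univ)) = 2 * ∑ i ∈ π, inner ℝ (WithLp.toLp 2 (Z i))
        (featureMean Z Finset.univ) := fun π _ => by
      rw [← sum_inner, ← card_smul_featureMean, real_inner_smul_left]
      ring
    rw [Finset.sum_congr rfl this, ← Finset.mul_sum, sum_parts_sum, ← sum_inner,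
      ← card_smul_featureMean, real_inner_smul_left, real_inner_self_eq_norm_sq, Finset.card_univ,
      Fintype.card_fin]
  have h3 : ∑ π ∈ Q.parts, (π.card : ℝ) * ‖featureMean Z Finset.univ‖ ^ 2 =
      N * ‖featureMean Z Finset.univ‖ ^ 2 := by
    rw [← Finset.sum_mul, ← Nat.cast_sum, Q.sum_card_parts, Finset.card_univ, Fintype.card_fin]
  rw [h2, h3]
  ring

theorem intraClass_nonneg (Q : Finpartition (Finset.univ : Finset (Fin N)))
    (Z : Matrix (Fin N) (Fin k) ℝ) : 0 ≤ intraClass Q Z :=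
  Finset.sum_nonneg fun _ _ => Finset.sum_nonneg fun _ _ => sq_nonneg _

/-- The shape given by the quotient rule: `-(a/b)' = (1/b)((a/b) b' - a')`, with `a` the intra-class
and `b` the inter-class measure. -/
theorem upsilon_eq (Q : Finpartition (Finset.univ : Finset (Fin N))) (η : ℝ) :
    upsilon Q η = η • interForm Q - intraForm Q := by
  rw [upsilon, interForm, intraForm, div_eq_mul_inv]
  module

theorem classAverage_transpose (Q : Finpartition (Finset.univ : Finset (Fin N))) :
    (classAverage Q)ᵀ = classAverage Q := by
  ext x y
  simp only [transpose_apply, classAverage]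
  by_cases h : Q.part x = Q.part y
  · rw [if_pos h, if_pos h.symm, h]
  · rw [if_neg h, if_neg (Ne.symm h)]

theorem upsilon_transpose (Q : Finpartition (Finset.univ : Finset (Fin N))) (η : ℝ) :
    (upsilon Q η)ᵀ = upsilon Q η := by
  rw [upsilon, transpose_sub, transpose_sub, transpose_smul, transpose_smul,
    classAverage_transpose, transpose_one, transpose_vecMulVec]

theorem classAverage_mem (Q : Finpartition (Finset.univ : Finset (Fin N))) (x y : Fin N) :
    0 ≤ classAverage Q x y ∧ classAverage Q x y ≤ 1 := by
  rw [classAverage]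
  split_ifs
  · exact ⟨by positivity, Nat.cast_inv_le_one _⟩
  · exact ⟨le_rfl, zero_le_one⟩

theorem part_card_pos (Q : Finpartition (Finset.univ : Finset (Fin N))) (x : Fin N) :
    0 < ((Q.part x).card : ℝ) := by
  exact_mod_cast Finset.card_pos.2 ⟨x, Q.mem_part (Finset.mem_univ x)⟩

theorem upsilon_pos (Q : Finpartition (Finset.univ : Finset (Fin N))) {η : ℝ} (hη : 0 ≤ η)
    {x y : Fin N} (hxy : x ≠ y) (h : Q.part x = Q.part y) : 0 < upsilon Q η x y := by
  have h1 := part_card_pos Q x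
  have h2 : ((Q.part x).card : ℝ) ≤ N := by
    exact_mod_cast (Finset.card_le_univ _).trans_eq (Fintype.card_fin N)
  have h3 : (N : ℝ)⁻¹ ≤ ((Q.part x).card : ℝ)⁻¹ := inv_anti₀ h1 h2
  have h4 : 0 < (N : ℝ)⁻¹ := inv_pos.2 (h1.trans_le h2)
  simp only [upsilon, Matrix.sub_apply, Matrix.smul_apply, classAverage, if_pos h, smul_eq_mul,
    Matrix.one_apply_ne hxy, vecMulVec_apply, Pi.one_apply, mul_one, sub_zero, div_eq_mul_inv]
  nlinarith

theorem upsilon_neg (Q : Finpartition (Finset.univ : Finset (Fin N))) {η : ℝ} (hη : 0 < η)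
    {x y : Fin N} (h : Q.part x ≠ Q.part y) : upsilon Q η x y < 0 := by
  have hxy : x ≠ y := fun e => h (by rw [e])
  have hN : 0 < (N : ℝ) := by exact_mod_cast x.pos
  simp only [upsilon, Matrix.sub_apply, Matrix.smul_apply, classAverage, if_neg h, smul_eq_mul,
    Matrix.one_apply_ne hxy, vecMulVec_apply, Pi.one_apply, mul_one, sub_zero, mul_zero, zero_sub]
  exact neg_neg_of_pos (by positivity)

end KMeans

/-! ### Trace bounds and the expansion of the quotient. -/

section TraceBounds

attribute [local instance] Matrix.frobeniusNormedAddCommGroup Matrix.frobeniusNormedSpace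
  Matrix.frobeniusNormedRing Matrix.frobeniusNormedAlgebra

variable {N : ℕ}

theorem abs_trace_mul_le {Y : Matrix (Fin N) (Fin N) ℝ} (hY : ∀ i j, |Y i j| ≤ 1)
    (X : Matrix (Fin N) (Fin N) ℝ) : |trace (Y * X)| ≤ N * N * ‖X‖ := by
  refine (abs_trace_le_frobenius _).trans ?_
  rw [mul_assoc]
  refine mul_le_mul_of_nonneg_left ?_ (Nat.cast_nonneg N)
  refine (norm_mul_le _ _).trans (mul_le_mul_of_nonneg_right ?_ (norm_nonneg _))
  simpa using frobenius_le_of_abs_apply_le zero_le_one hY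

theorem abs_intraForm_le (Q : Finpartition (Finset.univ : Finset (Fin N))) (i j : Fin N) :
    |intraForm Q i j| ≤ 1 := by
  have h := classAverage_mem Q i j
  rw [intraForm, Matrix.sub_apply, Matrix.one_apply]
  split_ifs <;> rw [abs_le] <;> constructor <;> linarith

theorem abs_interForm_le (Q : Finpartition (Finset.univ : Finset (Fin N))) (i j : Fin N) :
    |interForm Q i j| ≤ 1 := by
  have h := classAverage_mem Q i j
  have h1 : (0 : ℝ) ≤ (N : ℝ)⁻¹ := by positivity
  have h2 : (N : ℝ)⁻¹ ≤ 1 := Nat.cast_inv_le_one _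
  simp only [interForm, Matrix.sub_apply, Matrix.smul_apply, vecMulVec_apply, Pi.one_apply,
    smul_eq_mul, mul_one]
  rw [abs_le]
  constructor <;> linarith

/-- First-order expansion of a quotient, with an explicit constant. -/
theorem abs_div_sub_div_sub_le {a b a' b' ad bd δ h K m : ℝ} (hm : 0 < m) (hK : 0 ≤ K)
    (hδ : 0 < δ) (hδh : δ ^ 2 ≤ h) (hb : m ≤ b) (hbd : m / 2 ≤ bd) (ha : |a| ≤ K)
    (hbK : |b| ≤ K) (ha' : |a'| ≤ K) (hb' : |b'| ≤ K) (hra : |ad - a - δ * a'| ≤ K * h)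
    (hrb : |bd - b - δ * b'| ≤ K * h) (hbb : |bd - b| ≤ K * δ) :
    |a / b - ad / bd - δ * (1 / b) * (a / b * b' - a')| ≤
      (4 * K ^ 2 / m ^ 2 + 4 * K ^ 3 / m ^ 3) * h := by
  have hb0 : 0 < b := hm.trans_le hb
  have hbd0 : 0 < bd := (half_pos hm).trans_le hbd
  have hh : 0 ≤ h := (sq_nonneg δ).trans hδh
  -- The first fraction collects the remainders of the two expansions; the second is the cost of
  -- replacing `1 / (b * bd)` by `1 / b ^ 2` in the linear term, which is `O(δ²)`.
  have e : a / b - ad / bd - δ * (1 / b) * (a / b * b' - a') =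
      (a * (bd - b - δ * b') - b * (ad - a - δ * a')) / (b * bd) -
        δ * (a * b' - b * a') * (bd - b) / (b ^ 2 * bd) := by
    field_simp
    ring
  have h1 : |a * (bd - b - δ * b') - b * (ad - a - δ * a')| ≤ 2 * K ^ 2 * h := by
    calc _ ≤ |a| * |bd - b - δ * b'| + |b| * |ad - a - δ * a'| := by
          rw [← abs_mul, ← abs_mul]; exact abs_sub _ _
      _ ≤ K * (K * h) + K * (K * h) := by gcongr
      _ = _ := by ring
  have h2 : |δ * (a * b' - b * a') * (bd - b)| ≤ 2 * K ^ 3 * h := by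
    have h3 : |a * b' - b * a'| ≤ 2 * K ^ 2 := by
      calc _ ≤ |a| * |b'| + |b| * |a'| := by
            rw [← abs_mul, ← abs_mul]; exact abs_sub _ _
        _ ≤ K * K + K * K := by gcongr
        _ = _ := by ring
    calc _ = δ * |a * b' - b * a'| * |bd - b| := by rw [abs_mul, abs_mul, abs_of_pos hδ]
      _ ≤ δ * (2 * K ^ 2) * (K * δ) := by gcongr
      _ = 2 * K ^ 3 * δ ^ 2 := by ring
      _ ≤ _ := by gcongr
  rw [e]
  calc _ ≤ |(a * (bd - b - δ * b') - b * (ad - a - δ * a')) / (b * bd)| +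
        |δ * (a * b' - b * a') * (bd - b) / (b ^ 2 * bd)| := abs_sub _ _
    _ ≤ 2 * K ^ 2 * h / (m * (m / 2)) + 2 * K ^ 3 * h / (m ^ 2 * (m / 2)) := by
        rw [abs_div, abs_div, abs_of_pos (mul_pos hb0 hbd0),
          abs_of_pos (mul_pos (pow_pos hb0 2) hbd0)]
        gcongr
    _ = _ := by field_simp; ring

theorem trace_mul_transpose_comm {Y X : Matrix (Fin N) (Fin N) ℝ} (hY : Yᵀ = Y) :
    trace (Y * Xᵀ) = trace (Y * X) := by
  rw [← trace_transpose, Matrix.transpose_mul, transpose_transpose, hY, trace_mul_comm]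

namespace GraphPerturbation

variable {k : ℕ} {hk : k < N} {c g : ℝ} (D : GraphPerturbation hk c g)

/-- Against a symmetric `Y` a matrix and its transpose have the same trace, so `PW + WP` counts as
`2PW` and `TL + LT` as `2TL`; moreover `2PW - PWP = PW(1 + (1 - P))`. -/
theorem leadingTrace_eq {Y : Matrix (Fin N) (Fin N) ℝ} (hY : Yᵀ = Y) :
    leadingTrace hk Y D.l D.U D.σ = trace (Y * D.dS) := by
  have hP : D.Pᵀ = D.P := specProj_transpose k D.U
  have hW : D.Wᵀ = D.W := transpose_vecMulVec _ _
  have hL : D.Lᵀ = D.L := diagonal_transpose _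
  have hT : D.Tᵀ = D.T := by
    rw [show D.T = truncation hk D.U D.σ from rfl, truncation_eq_conj, conj_diagonal_transpose]
  have e1 : trace (Y * (D.W * D.P)) = trace (Y * (D.P * D.W)) := by
    rw [← trace_mul_transpose_comm hY, Matrix.transpose_mul, hP, hW]
  have e2 : trace (Y * (D.L * D.T)) = trace (Y * (D.T * D.L)) := by
    rw [← trace_mul_transpose_comm hY, Matrix.transpose_mul, hT, hL]
  rw [leadingTrace, topVecs_mul_transpose, nullVecs_mul_transpose hk D.svd.orthogonal]
  change trace (Y * (D.P * D.W * (1 + (1 - D.P)) - (2 : ℝ) • (D.T * D.L))) = _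
  simp only [dS, Matrix.mul_add, Matrix.mul_sub, Matrix.mul_one, Matrix.mul_smul, trace_add,
    trace_sub, trace_smul, e1, e2, smul_eq_mul]
  ring

/-- The uniform first-order expansion of the K-means measure. -/
theorem exists_kmeans_expansion (hk0 : 0 < k) (hk : k < N) {c g m : ℝ} (hc : 0 < c) (hg : 1 < g)
    (hm : 0 < m) :
    ∃ C δ₀ : ℝ, 0 < C ∧ 0 < δ₀ ∧ δ₀ ≤ 1 ∧
      ∀ (D : GraphPerturbation hk c g) (Q : Finpartition (Finset.univ : Finset (Fin N)))
        (Z Zδ : Matrix (Fin N) (Fin k) ℝ), Z * Zᵀ = D.T → Zδ * Zδᵀ = D.gram → D.δ ≤ δ₀ →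
        m ≤ interClass Q Z →
        |(kmeansMeasure Q Z - kmeansMeasure Q Zδ) - D.δ * eta₁ Q Z *
            leadingTrace hk (upsilon Q (eta₂ Q Z)) D.l D.U D.σ| ≤ C * (D.ε + D.δ ^ 2) := by
  obtain ⟨K₁, hK₁⟩ := Asymptotics.isBigO_top.1 (isBigO_gram_sub (hk := hk) hk0 hc hg)
  obtain ⟨K₂, hK₂⟩ := Asymptotics.isBigO_top.1 (isBigO_gram_sub_T (hk := hk) hk0 hc hg)
  obtain ⟨K₃, hK₃⟩ := Asymptotics.isBigO_top.1 (isBigO_T (hk := hk) (c := c) (g := g))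
  obtain ⟨K₄, hK₄⟩ := Asymptotics.isBigO_top.1 (isBigO_dS (hk := hk) (c := c) (g := g))
  have hN : 0 < (N : ℝ) := by exact_mod_cast hk0.trans hk
  set K₀ : ℝ := |K₁| + |K₂| + |K₃| + |K₄| + 1 with hK₀
  have hK₀0 : 0 < K₀ := by positivity
  set K : ℝ := N * N * K₀ with hK
  have hK0 : 0 < K := by positivity
  have n1 := abs_nonneg K₁
  have n2 := abs_nonneg K₂
  have n3 := abs_nonneg K₃
  have n4 := abs_nonneg K₄
  -- The choice `δ₀ ≤ m / (2K)` keeps the perturbed inter-class measure above `m / 2`. `K` is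
  -- independent of the partition since both forms have entries in `[-1, 1]`.
  refine ⟨4 * K ^ 2 / m ^ 2 + 4 * K ^ 3 / m ^ 3, min 1 (m / (2 * K)), by positivity,
    by positivity, min_le_left _ _, fun D Q Z Zδ hZ hZδ hδ hmZ => ?_⟩
  have hh : 0 ≤ D.ε + D.δ ^ 2 := add_nonneg D.ε_nonneg (sq_nonneg _)
  have b1 : ‖D.gram - D.T - D.δ • D.dS‖ ≤ K₀ * (D.ε + D.δ ^ 2) := by
    refine (hK₁ D).trans ?_
    rw [Real.norm_of_nonneg hh]
    exact mul_le_mul_of_nonneg_right (by linarith [le_abs_self K₁]) hh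
  have b2 : ‖D.gram - D.T‖ ≤ K₀ * D.δ := by
    refine (hK₂ D).trans ?_
    rw [Real.norm_of_nonneg D.δ_pos.le]
    exact mul_le_mul_of_nonneg_right (by linarith [le_abs_self K₂]) D.δ_pos.le
  have b3 : ‖D.T‖ ≤ K₀ := by
    refine (hK₃ D).trans ?_
    rw [norm_one, mul_one]
    linarith [le_abs_self K₃]
  have b4 : ‖D.dS‖ ≤ K₀ := by
    refine (hK₄ D).trans ?_
    rw [norm_one, mul_one]
    linarith [le_abs_self K₄]
  have tr {Y X : Matrix (Fin N) (Fin N) ℝ} {r : ℝ} (hY : ∀ i j, |Y i j| ≤ 1)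
      (hX : ‖X‖ ≤ K₀ * r) : |trace (Y * X)| ≤ K * r := by
    refine (abs_trace_mul_le hY X).trans ?_
    rw [hK, mul_assoc _ K₀]
    exact mul_le_mul_of_nonneg_left hX (by positivity)
  have tr1 {Y X : Matrix (Fin N) (Fin N) ℝ} (hY : ∀ i j, |Y i j| ≤ 1)
      (hX : ‖X‖ ≤ K₀) : |trace (Y * X)| ≤ K := by
    simpa using tr (r := 1) hY (by simpa using hX)
  have split (Y : Matrix (Fin N) (Fin N) ℝ) :
      trace (Y * D.gram) - trace (Y * D.T) - D.δ * trace (Y * D.dS) =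
        trace (Y * (D.gram - D.T - D.δ • D.dS)) := by
    simp [Matrix.mul_sub, trace_sub]
  have split' (Y : Matrix (Fin N) (Fin N) ℝ) :
      trace (Y * D.gram) - trace (Y * D.T) = trace (Y * (D.gram - D.T)) := by
    simp [Matrix.mul_sub, trace_sub]
  have hbb : |interClass Q Zδ - interClass Q Z| ≤ K * D.δ := by
    rw [interClass_eq, interClass_eq, hZ, hZδ, split']
    exact tr (abs_interForm_le Q) b2
  have hbd : m / 2 ≤ interClass Q Zδ := by
    have h1 : K * D.δ ≤ m / 2 := by
      have := hδ.trans (min_le_right _ _)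
      rw [le_div_iff₀ (by positivity)] at this
      linarith
    have := (abs_le.1 hbb).1
    linarith
  have main := abs_div_sub_div_sub_le (a := intraClass Q Z) (b := interClass Q Z)
    (ad := intraClass Q Zδ) (bd := interClass Q Zδ) (a' := trace (intraForm Q * D.dS))
    (b' := trace (interForm Q * D.dS)) (h := D.ε + D.δ ^ 2) hm hK0.le D.δ_pos
    (by linarith [D.ε_nonneg]) hmZ hbd
    (by rw [intraClass_eq, hZ]; exact tr1 (abs_intraForm_le Q) b3)
    (by rw [interClass_eq, hZ]; exact tr1 (abs_interForm_le Q) b3)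
    (tr1 (abs_intraForm_le Q) b4) (tr1 (abs_interForm_le Q) b4)
    (by rw [intraClass_eq, intraClass_eq, hZ, hZδ, split]; exact tr (abs_intraForm_le Q) b1)
    (by rw [interClass_eq, interClass_eq, hZ, hZδ, split]; exact tr (abs_interForm_le Q) b1)
    hbb
  rw [D.leadingTrace_eq (upsilon_transpose _ _), upsilon_eq, Matrix.sub_mul, Matrix.smul_mul,
    trace_sub, trace_smul, smul_eq_mul]
  exact main

end GraphPerturbation

end TraceBounds

/-! ### The augmentation graph -/

section Graph

variable {Ω : Type*} [MeasurableSpace Ω] {N : ℕ}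

theorem unlabeledAdj_nonneg (P : Measure Ω) (T : Kernel Ω (Fin N)) (x y : Fin N) :
    0 ≤ unlabeledAdj P T x y :=
  integral_nonneg fun _ => mul_nonneg measureReal_nonneg measureReal_nonneg

theorem labelVec_nonneg (Pl : Measure Ω) (T : Kernel Ω (Fin N)) (x : Fin N) :
    0 ≤ labelVec Pl T x :=
  integral_nonneg fun _ => measureReal_nonneg

theorem sum_labelVec (Pl : Measure Ω) [IsProbabilityMeasure Pl] (T : Kernel Ω (Fin N))
    [IsMarkovKernel T] : ∑ x, labelVec Pl T x = 1 := by
  simp only [labelVec]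
  rw [← integral_finsetSum]
  · have : ∀ w, ∑ x, (T w).real {x} = 1 := fun w => by
      rw [sum_measureReal_singleton]
      simp
    simp [this]
  · intro x _
    refine Integrable.of_bound (C := 1) ?_ (Filter.Eventually.of_forall fun w => ?_)
    · exact (T.measurable_coe (measurableSet_singleton x)).ennreal_toReal.aestronglyMeasurable
    · rw [Real.norm_of_nonneg measureReal_nonneg]
      exact measureReal_le_one

theorem adj_eq_adj_zero_add (P Pl : Measure Ω) (T : Kernel Ω (Fin N)) (ηu δ : ℝ) :
    adj P Pl T ηu δ = adj P Pl T ηu 0 + δ • vecMulVec (labelVec Pl T) (labelVec Pl T) := by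
  simp [adj]

theorem adj_zero_nonneg {P Pl : Measure Ω} {T : Kernel Ω (Fin N)} {ηu : ℝ}
    (h : ∀ x, degree (adj P Pl T ηu 0) x = 1) (x y : Fin N) : 0 ≤ adj P Pl T ηu 0 x y := by
  have e : ∀ x y, adj P Pl T ηu 0 x y = ηu * unlabeledAdj P T x y := fun x y => by simp [adj]
  have h1 := h x
  simp only [degree, e, ← Finset.mul_sum] at h1
  have h2 : 0 ≤ ∑ y, unlabeledAdj P T x y :=
    Finset.sum_nonneg fun y _ => unlabeledAdj_nonneg P T x y
  -- No sign of `ηu` is assumed: a negative value would make the row sum nonpositive instead of `1`.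
  have h3 : 0 ≤ ηu := by
    by_contra hn
    nlinarith
  rw [e]
  exact mul_nonneg h3 (unlabeledAdj_nonneg P T x y)

theorem degInvSqrt_eq_one {B : Matrix (Fin N) (Fin N) ℝ} (h : ∀ x, degree B x = 1) :
    degInvSqrt B = 1 := by
  simp [degInvSqrt, h]

theorem mul_succValue_le_of_le_spectralGap {k : ℕ} {hk : k < N} {σ : Fin N → ℝ} {g : ℝ}
    (hσ : ∀ j, 0 ≤ σ j) (hg : 0 ≤ g) (h : ENNReal.ofReal g ≤ spectralGap hk σ) :
    g * succValue hk σ ≤ kthValue hk σ := by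
  have hs : 0 ≤ succValue hk σ := hσ _
  have ht : 0 ≤ kthValue hk σ := hσ _
  rcases hs.eq_or_lt with h0 | h0
  · rw [← h0, mul_zero]; exact ht
  · rw [spectralGap, ENNReal.le_div_iff_mul_le (Or.inl (by simpa using h0))
      (Or.inl ENNReal.ofReal_ne_top), ← ENNReal.ofReal_mul hg, ENNReal.ofReal_le_ofReal_iff ht] at h
    exact h

theorem toReal_inv_spectralGap {k : ℕ} {hk : k < N} {σ : Fin N → ℝ} (hσ : ∀ j, 0 ≤ σ j)
    (h : 0 < kthValue hk σ) :
    (spectralGap hk σ)⁻¹.toReal = succValue hk σ / kthValue hk σ := by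
  have hs : 0 ≤ succValue hk σ := hσ _
  rw [spectralGap, ENNReal.inv_div (Or.inl ENNReal.ofReal_ne_top) (Or.inr (by simpa using h)),
    ENNReal.toReal_div, ENNReal.toReal_ofReal hs, ENNReal.toReal_ofReal h.le]

end Graph

end OpenWorld

/-! ### The main theorem. -/

theorem theorem4p3 (N k : ℕ) (hk0 : 0 < k) (hk : k < N) (c m g : ℝ)
    (hc : 0 < c) (hm : 0 < m) (hg : 1 < g) :
    ∃ C δ₀ : ℝ, 0 < C ∧ 0 < δ₀ ∧
      ∀ (Ω : Type*) [MeasurableSpace Ω] (P Pl : Measure Ω)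
        [IsProbabilityMeasure P] [IsProbabilityMeasure Pl]
        (T : Kernel Ω (Fin N)) [IsMarkovKernel T] (ηu : ℝ)
        (Q : Finpartition (Finset.univ : Finset (Fin N)))
        (U : Matrix (Fin N) (Fin N) ℝ) (σ : Fin N → ℝ) (Z : Matrix (Fin N) (Fin k) ℝ),
        (∀ x, OpenWorld.degree (OpenWorld.adj P Pl T ηu 0) x = 1) →
        OpenWorld.IsSymmSVD (OpenWorld.normAdj (OpenWorld.adj P Pl T ηu 0)) U σ →
        OpenWorld.IsFeature hk (OpenWorld.adj P Pl T ηu 0) Z →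
        c ≤ OpenWorld.kthValue hk σ →
        ENNReal.ofReal g ≤ OpenWorld.spectralGap hk σ →
        m ≤ OpenWorld.interClass Q Z →
        (∀ δ : ℝ, 0 < δ → δ ≤ δ₀ → ∀ Zδ : Matrix (Fin N) (Fin k) ℝ,
          OpenWorld.IsFeature hk (OpenWorld.adj P Pl T ηu δ) Zδ →
          |(OpenWorld.kmeansMeasure Q Z - OpenWorld.kmeansMeasure Q Zδ)
              - δ * OpenWorld.eta₁ Q Z *
                OpenWorld.leadingTrace hk (OpenWorld.upsilon Q (OpenWorld.eta₂ Q Z))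
                  (OpenWorld.labelVec Pl T) U σ|
            ≤ C * ((OpenWorld.spectralGap hk σ)⁻¹.toReal + δ ^ 2)) ∧
        (∀ x x', x ≠ x' → Q.part x = Q.part x' →
          0 < OpenWorld.upsilon Q (OpenWorld.eta₂ Q Z) x x') ∧
        (∀ x x', Q.part x ≠ Q.part x' → 0 < OpenWorld.eta₂ Q Z →
          OpenWorld.upsilon Q (OpenWorld.eta₂ Q Z) x x' < 0) := by
  obtain ⟨C, δ₀, hC, hδ₀, hδ₀1, H⟩ :=
    OpenWorld.GraphPerturbation.exists_kmeans_expansion hk0 hk hc hg hm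
  refine ⟨C, δ₀, hC, hδ₀, ?_⟩
  intro Ω _ P Pl _ _ T _ ηu Q U σ Z hdeg hsvd hZ hkth hgap hinter
  have hkth0 : 0 < OpenWorld.kthValue hk σ := hc.trans_le hkth
  have hgap' := OpenWorld.mul_succValue_le_of_le_spectralGap hsvd.nonneg (by linarith) hgap
  have hη : 0 ≤ OpenWorld.eta₂ Q Z :=
    div_nonneg (OpenWorld.intraClass_nonneg Q Z) (hm.le.trans hinter)
  refine ⟨fun δ hδ hδle Zδ hZδ => ?_, fun x x' hx hxx => OpenWorld.upsilon_pos Q hη hx hxx,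
    fun x x' hxx hη' => OpenWorld.upsilon_neg Q hη' hxx⟩
  have hD := OpenWorld.degInvSqrt_eq_one hdeg
  -- `Z` may come from a different decomposition than `U`, `σ`; the gap makes the truncation
  -- independent of this choice.
  have hgram : Z * Zᵀ = OpenWorld.truncation hk U σ := by
    obtain ⟨U₀, σ₀, h₀, hZ₀⟩ := hZ
    rw [hZ₀, hD, Matrix.one_mul, Matrix.mul_one]
    refine hsvd.truncation_unique hk0 hk ?_ h₀
    have : 0 ≤ OpenWorld.succValue hk σ := hsvd.nonneg _
    nlinarith
  obtain ⟨U', σ', h', hZ'⟩ := hZδ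
  rw [OpenWorld.adj_eq_adj_zero_add] at h' hZ'
  have hsvd' : OpenWorld.IsSymmSVD (OpenWorld.adj P Pl T ηu 0) U σ := by
    rwa [OpenWorld.normAdj, hD, Matrix.one_mul, Matrix.mul_one] at hsvd
  rw [OpenWorld.toReal_inv_spectralGap hsvd.nonneg hkth0]
  exact H
    { B := OpenWorld.adj P Pl T ηu 0
      l := OpenWorld.labelVec Pl T
      δ := δ
      U := U
      σ := σ
      U' := U'
      σ' := σ'
      B_nonneg := OpenWorld.adj_zero_nonneg hdeg
      B_sum := hdeg
      l_nonneg := OpenWorld.labelVec_nonneg Pl T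
      l_sum := OpenWorld.sum_labelVec Pl T
      δ_pos := hδ
      δ_le := hδle.trans hδ₀1
      svd := hsvd'
      svd' := h'
      le_kth := hkth
      gap := hgap' } Q Z Zδ hgram hZ' hδle hinter
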